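/- **Setting.** Let $n,k,m\ge 0$ be integers. For a $2n$-qubit pure state $|\psi\rangle=\sum_{ij}\psi_{ij}|i\rangle|j\rangle$ ($i,j$ ranging over $n$-bit strings) let $\mathcal V$ be the vectorization map $\mathcal V[\sum_{ij}o_{ij}|i\rangle\langle j|]=\sum_{ij}o_{ij}|i\rangle|j\rangle$. A unitary $U_B$ on $n+k$ qubits is an $(n+k,\lambda)$-UBSE of the $2n$-qubit pure state $|B\rangle$ if $\lambda\ge0$ and $\mathcal V[(I_n\otimes\langle0|_k)U_B(I_n\otimes|0\rangle_k)]=\lambda|B\rangle$. A density matrix $\rho_A$ on $1+n$ qubits is a $(1+n,0,1,\gamma)$-DMSE of the $2n$-qubit pure state $|A\rangle$ if $\gamma\ge0$ and $\mathcal V[(\langle0|\otimes I_n)\rho_A(|1\rangle\otimes I_n)]=\gamma|A\rangle$. Let $|S_A\rangle$ be an $(m+1+n)$-qubit purification of $\rho_A$, i.e. $\mathrm{Tr}_m|S_A\rangle\langle S_A|=\rho_A$, and let $U_{SA}$ be a unitary with $U_{SA}|0\rangle_{m+1+n}=|S_A\rangle$. Assume $\lambda>0$ and $\gamma>0$, and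 put $\mu_r=\mathrm{Re}\langle B|A\rangle$, $\mu_i=\mathrm{Im}\langle B|A\rangle$. Let $$W_r=|00\rangle\langle00|\otimes X\otimes U_B+i|01\rangle\langle01|\otimes Y\otimes U_B+|10\rangle\langle10|\otimes X\otimes U_B^\dagger-i|11\rangle\langle11|\otimes Y\otimes U_B^\dagger,$$ $$W_i=i|00\rangle\langle00|\otimes X\otimes U_B-|01\rangle\langle01|\otimes Y\otimes U_B-i|10\rangle\langle10|\otimes X\otimes U_B^\dagger-|11\rangle\langle11|\otimes Y\otimes U_B^\dagger,$$ $U_{B,r1}=(H\otimes H\otimes I)W_r(H\otimes H\otimes I)$, $U_{B,i1}=(H\otimes H\otimes I)W_i(H\otimes H\otimes I)$, and, on $1+2+m+1+n+k$ qubits and for $q\in\{r,i\}$, $$U_{B,q2}=(H\otimes I)\bigl(|0\rangle\langle0|\otimes I+|1\rangle\langle1|\otimes (I_m\otimes U_{B,q1})\bigr)(H\otimes I),$$ where $U_{B,q1}$ acts on the two LCU ancillas and on the last $1+n+k$ qubits. Write $|0S_A0\rangle=|000\rangle|S_A\rangle|0\rangle_k$ and let $U_{G,q}=-(I-2U_{B,q2}|0S_A0\rangle\langle0S_A0|U_{B,q2}^\dagger)(I-2|0S_A0\rangle\langle0S_A0|)$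 be the Grover operator. An *amplitude estimation procedure* is a (possibly non-terminating) deterministic classical controller that, as a function of the measurement results so far, either chooses an integer $t\ge0$ or stops and outputs a real number $\bar a$. When it chooses $t$, the state $U_{G,q}^{\,t}\,U_{B,q2}|0S_A0\rangle$ is prepared afresh and the controller learns whether the measurement finds it in $|0S_A0\rangle$. This is carried out by an explicit circuit on the $m+n+k+4$ qubits that starts in the all-zero state, is made of gates not depending on $U_B,U_{SA}$ and of (possibly controlled) uses of $U_B,U_B^\dagger,U_{SA},U_{SA}^\dagger$, and ends with a measurement in the computational basis. Every use of one of these four is one query; a circuit with $t$ Grover iterations makes $8t+4$ queries. **Theorem (h.l. estimation by state matrixization).** For every $\delta_0<1$ there is a constant $C>0$, depending on nothing but $\delta_0$, such that for all $\varepsilon>0$ and $0<\delta\le\delta_0$ there is an amplitude estimation procedure (depending only on $\varepsilon$ and $\delta$; in particular not on the unknown $\mu_r,\mu_i$) such that for all data as above and for both $q=r$ and $q=i$: 1. the circuit with $t$ Grover iterations implements exactly $(I\otimes U_{SA}^\dagger\otimes I)\,U_{G,q}^{\,t}\,U_{B,q2}\,(I\otimes U_{SA}\otimes I)$, for every $t\ge0$;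 2. $\dfrac{2\,|\langle0S_A0|U_{B,q2}|0S_A0\rangle|-1}{\gamma\lambda}=\mu_q$; 3. if $\mu_q\ne0$, then with probability at least $1-\delta$ the procedure stops after at most $$C\,\gamma^{-1}\lambda^{-1}|\mu_q|^{-1}\varepsilon^{-1}\log(\delta^{-1})$$ queries in total and its output $\bar a$ gives an estimate $\bar\mu_q=(2\bar a-1)/(\gamma\lambda)$ with $|\bar\mu_q-\mu_q|\le\varepsilon|\mu_q|$. -/

import Mathlib

open scoped Matrix Kronecker ComplexOrder

namespace StateMatrixization

noncomputable section

/-! ## Kets, vectorization, and the two encodings -/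

/-- Labels of the computational basis of an `n`-qubit register. The label `0` is the all-zero
string. A single qubit is labelled by `Fin 2`. -/
abbrev Qubits (n : ℕ) : Type := Fin n → Fin 2

/-- Vectors of the Hilbert space with orthonormal basis labelled by `ι`. -/
abbrev Ket (ι : Type) : Type := ι → ℂ

/-- The basis ket with label `i`. -/
def basisKet {ι : Type} [DecidableEq ι] (i : ι) : Ket ι := Pi.single i 1

/-- The inner product `⟨φ|ψ⟩`, conjugate linear in `φ`. -/
def braket {ι : Type} [Fintype ι] (φ ψ : Ket ι) : ℂ := star φ ⬝ᵥ ψ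

/-- Pure states are unit vectors. -/
def IsPureState {ι : Type} [Fintype ι] (ψ : Ket ι) : Prop := braket ψ ψ = 1

/-- The operator `|ψ⟩⟨ψ|`. -/
def ketbra {ι : Type} (ψ : Ket ι) : Matrix ι ι ℂ := Matrix.vecMulVec ψ (star ψ)

/-- Vectorization: `∑ oᵢⱼ |i⟩⟨j|` is sent to `∑ oᵢⱼ |i⟩|j⟩`. -/
def vectorize {α β : Type} (O : Matrix α β ℂ) : Ket (α × β) := fun p => O p.1 p.2

/-- Density matrices. -/
def IsDensityMatrix {ι : Type} [Fintype ι] (ρ : Matrix ι ι ℂ) : Prop :=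
  ρ.PosSemidef ∧ ρ.trace = 1

/-- `U` is an `(n+k, lam)`-unitary block state encoding of the `2n`-qubit pure state `B`. -/
def IsUBSE {n k : ℕ} (U : Matrix (Qubits n × Qubits k) (Qubits n × Qubits k) ℂ) (lam : ℝ)
    (B : Ket (Qubits n × Qubits n)) : Prop :=
  U ∈ Matrix.unitaryGroup (Qubits n × Qubits k) ℂ ∧ 0 ≤ lam ∧ IsPureState B ∧
    vectorize (Matrix.of fun i j : Qubits n => U (i, 0) (j, 0)) = (lam : ℂ) • B

/-- `ρ` is an `(l+n, s₁, s₂, γ)`-density matrix state encoding of the `2n`-qubit pure state `A`.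
Here `L` labels the computational basis of the `l`-qubit ancilla: `L = Fin 2` when `l = 1`. -/
def IsDMSE {L : Type} [Fintype L] {n : ℕ} (ρ : Matrix (L × Qubits n) (L × Qubits n) ℂ)
    (s₁ s₂ : L) (γ : ℝ) (A : Ket (Qubits n × Qubits n)) : Prop :=
  IsDensityMatrix ρ ∧ s₁ ≠ s₂ ∧ 0 ≤ γ ∧ IsPureState A ∧
    vectorize (Matrix.of fun i j : Qubits n => ρ (s₁, i) (s₂, j)) = (γ : ℂ) • A

/-- Trace over the first tensor factor. -/
def partialTraceFst {α β : Type} [Fintype α] (M : Matrix (α × β) (α × β) ℂ) : Matrix β β ℂ :=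
  Matrix.of fun i j => ∑ x, M (x, i) (x, j)

/-- `S` is a purification of `ρ`, the purifying register being the first factor. -/
def IsPurification {α β : Type} [Fintype α] (S : Ket (α × β)) (ρ : Matrix β β ℂ) : Prop :=
  partialTraceFst (ketbra S) = ρ

/-! ## The unitaries built by linear combination of unitaries -/

/-- Which part of `⟨B|A⟩` is estimated. -/
inductive Part : Type
  | re
  | im

/-- The real or the imaginary part of a complex number. -/
def Part.of : Part → ℂ → ℝ
  | .re, z => z.re
  | .im, z => z.im

def pauliX : Matrix (Fin 2) (Fin 2) ℂ := !![0, 1; 1, 0]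

def pauliY : Matrix (Fin 2) (Fin 2) ℂ := !![0, -Complex.I; Complex.I, 0]

def hadamard : Matrix (Fin 2) (Fin 2) ℂ := ((Real.sqrt 2 : ℝ) : ℂ)⁻¹ • !![1, 1; 1, -1]

/-- The projector onto a basis ket. -/
def proj {ι : Type} [DecidableEq ι] (i : ι) : Matrix ι ι ℂ := Matrix.single i i 1

/-- `W_r` and `W_i`, on the registers `(2, 1, n + k)`. -/
def lcuSelect {Q : Type} (U : Matrix Q Q ℂ) :
    Part → Matrix ((Fin 2 × Fin 2) × (Fin 2 × Q)) ((Fin 2 × Fin 2) × (Fin 2 × Q)) ℂ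
  | .re => proj (0, 0) ⊗ₖ (pauliX ⊗ₖ U) + Complex.I • (proj (0, 1) ⊗ₖ (pauliY ⊗ₖ U))
      + proj (1, 0) ⊗ₖ (pauliX ⊗ₖ Uᴴ) - Complex.I • (proj (1, 1) ⊗ₖ (pauliY ⊗ₖ Uᴴ))
  | .im => Complex.I • (proj (0, 0) ⊗ₖ (pauliX ⊗ₖ U)) - proj (0, 1) ⊗ₖ (pauliY ⊗ₖ U)
      - Complex.I • (proj (1, 0) ⊗ₖ (pauliX ⊗ₖ Uᴴ)) - proj (1, 1) ⊗ₖ (pauliY ⊗ₖ Uᴴ)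

/-- The LCU unitaries `(H ⊗ H ⊗ I) W (H ⊗ H ⊗ I)`. -/
def lcuUnitary {Q : Type} [Fintype Q] [DecidableEq Q] (U : Matrix Q Q ℂ) (p : Part) :
    Matrix ((Fin 2 × Fin 2) × (Fin 2 × Q)) ((Fin 2 × Fin 2) × (Fin 2 × Q)) ℂ :=
  ((hadamard ⊗ₖ hadamard) ⊗ₖ 1) * lcuSelect U p * ((hadamard ⊗ₖ hadamard) ⊗ₖ 1)

/-- Basis labels of the `m+n+k+4`-qubit workspace, with registers in the order
`(1, 2, m, 1, n, k)`: control, two LCU ancillas, purifying register, the ancilla qubit of the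
density matrix encoding, the `n`-qubit system, the ancillas of the block encoding. -/
abbrev Reg (m n k : ℕ) : Type :=
  Fin 2 × ((Fin 2 × Fin 2) × (Qubits m × (Fin 2 × (Qubits n × Qubits k))))

/-- On the space labelled by `ι ≃ D × R`: apply `f r` to the register `D`
when the remaining registers `R` are in the basis state `r`. -/
def multiplexed {ι D R : Type} [DecidableEq R] (e : ι ≃ D × R)
    (f : R → Matrix D D ℂ) : Matrix ι ι ℂ :=
  (Matrix.blockDiagonal f).submatrix e e

/-- Separates the purifying register from the registers the LCU unitaries act on. -/
def lcuEquiv (L M D : Type) : L × (M × D) ≃ (L × D) × M where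
  toFun p := ((p.1, p.2.2), p.2.1)
  invFun p := (p.1.1, (p.2, p.1.2))
  left_inv _ := rfl
  right_inv _ := rfl

/-- The controlled LCU unitaries `U_{B,r2}` and `U_{B,i2}`: the LCU unitary, controlled by the
first qubit, between two Hadamard gates on the first qubit. -/
def ctrlLCU {n k : ℕ} (m : ℕ) (UB : Matrix (Qubits n × Qubits k) (Qubits n × Qubits k) ℂ)
    (p : Part) : Matrix (Reg m n k) (Reg m n k) ℂ :=
  (hadamard ⊗ₖ 1) *
    (proj 0 ⊗ₖ 1 +
      proj 1 ⊗ₖ multiplexed (lcuEquiv (Fin 2 × Fin 2) (Qubits m) (Fin 2 × (Qubits n × Qubits k)))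
        (fun _ => lcuUnitary UB p)) *
    (hadamard ⊗ₖ 1)

/-- The state `|000⟩|S⟩|0⟩_k`. -/
def initKet {m n : ℕ} (k : ℕ) (S : Ket (Qubits m × (Fin 2 × Qubits n))) : Ket (Reg m n k) :=
  fun w => if w.1 = 0 ∧ w.2.1 = 0 ∧ w.2.2.2.2.2 = 0 then
    S (w.2.2.1, (w.2.2.2.1, w.2.2.2.2.1)) else 0

/-- The Grover operator `-(I - 2 U|0S0⟩⟨0S0|U†)(I - 2|0S0⟩⟨0S0|)` of `U = U_{B,r2}` or
`U = U_{B,i2}`. -/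
def groverOp {m n k : ℕ} (UB : Matrix (Qubits n × Qubits k) (Qubits n × Qubits k) ℂ)
    (S : Ket (Qubits m × (Fin 2 × Qubits n))) (p : Part) : Matrix (Reg m n k) (Reg m n k) ℂ :=
  -((1 - (2 : ℂ) • (ctrlLCU m UB p * ketbra (initKet k S) * (ctrlLCU m UB p)ᴴ)) *
    (1 - (2 : ℂ) • ketbra (initKet k S)))

/-! ## Circuits with queries -/

/-- Separates the `n+k` qubits that `U_B` acts on. -/
def regEquivB (m n k : ℕ) : Reg m n k ≃
    (Qubits n × Qubits k) × (Fin 2 × (Fin 2 × Fin 2) × Qubits m × Fin 2) where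
  toFun w := (w.2.2.2.2, (w.1, w.2.1, w.2.2.1, w.2.2.2.1))
  invFun q := (q.2.1, (q.2.2.1, (q.2.2.2.1, (q.2.2.2.2, q.1))))
  left_inv _ := rfl
  right_inv _ := rfl

/-- Separates the `m+1+n` qubits that the preparation unitary of `|S_A⟩` acts on. -/
def regEquivS (m n k : ℕ) : Reg m n k ≃
    (Qubits m × (Fin 2 × Qubits n)) × (Fin 2 × (Fin 2 × Fin 2) × Qubits k) where
  toFun w := ((w.2.2.1, (w.2.2.2.1, w.2.2.2.2.1)), (w.1, w.2.1, w.2.2.2.2.2))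
  invFun q := (q.2.1, (q.2.2.1, (q.1.1, (q.1.2.1, (q.1.2.2, q.2.2.2)))))
  left_inv _ := rfl
  right_inv _ := rfl

/-- Separates the control qubit and the two LCU ancillas. -/
def regEquivC (m n k : ℕ) : Reg m n k ≃
    (Fin 2 × (Fin 2 × Fin 2)) × (Qubits m × (Fin 2 × (Qubits n × Qubits k))) where
  toFun w := ((w.1, w.2.1), w.2.2)
  invFun q := (q.1.1, (q.1.2, q.2))
  left_inv _ := rfl
  right_inv _ := rfl

/-- Separates the ancilla qubit of the density matrix encoding. -/
def regEquivD (m n k : ℕ) : Reg m n k ≃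
    Fin 2 × (Fin 2 × (Fin 2 × Fin 2) × Qubits m × (Qubits n × Qubits k)) where
  toFun w := (w.2.2.2.1, (w.1, w.2.1, w.2.2.1, w.2.2.2.2))
  invFun q := (q.2.1, (q.2.2.1, (q.2.2.2.1, (q.1, q.2.2.2.2))))
  left_inv _ := rfl
  right_inv _ := rfl

/-- A gate on the workspace. `free V` is a fixed unitary, which makes no query. `queryB c adj`
applies `U_B` (or `U_B†` if `adj`) to its `n+k` qubits, controlled on those basis states of the
control qubit and of the two LCU ancillas for which `c` is true. `queryS adj` applies `U_{SA}`
(or `U_{SA}†` if `adj`) to its `m+1+n` qubits. -/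
inductive Gate (m n k : ℕ) : Type
  | free (V : Matrix.unitaryGroup (Reg m n k) ℂ)
  | queryB (c : Fin 2 × (Fin 2 × Fin 2) → Bool) (adj : Bool)
  | queryS (adj : Bool)

/-- `U`, or `U†` if `adj`. -/
def adjointIf {Q : Type} (adj : Bool) (U : Matrix Q Q ℂ) : Matrix Q Q ℂ :=
  if adj then Uᴴ else U

/-- The operator of a gate when the oracles are `UB` and `US`. -/
def Gate.eval {m n k : ℕ} (UB : Matrix (Qubits n × Qubits k) (Qubits n × Qubits k) ℂ)
    (US : Matrix (Qubits m × (Fin 2 × Qubits n)) (Qubits m × (Fin 2 × Qubits n)) ℂ) :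
    Gate m n k → Matrix (Reg m n k) (Reg m n k) ℂ
  | .free V => V
  | .queryB c adj => multiplexed (regEquivB m n k)
      (fun r => if c (r.1, r.2.1) then adjointIf adj UB else 1)
  | .queryS adj => multiplexed (regEquivS m n k) (fun _ => adjointIf adj US)

/-- The inverse gate. -/
def Gate.inv {m n k : ℕ} : Gate m n k → Gate m n k
  | .free V => .free V⁻¹
  | .queryB c adj => .queryB c !adj
  | .queryS adj => .queryS !adj

/-- The number of queries to `U_B`, `U_B†`, `U_{SA}`, `U_{SA}†` made by a gate. -/
def Gate.queries {m n k : ℕ} : Gate m n k → ℕ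
  | .free _ => 0
  | .queryB _ _ => 1
  | .queryS _ => 1

/-- A circuit is a list of gates, the first gate of the list being applied first. -/
abbrev Circuit (m n k : ℕ) : Type := List (Gate m n k)

/-- The operator of a circuit. -/
def Circuit.eval {m n k : ℕ} (UB : Matrix (Qubits n × Qubits k) (Qubits n × Qubits k) ℂ)
    (US : Matrix (Qubits m × (Fin 2 × Qubits n)) (Qubits m × (Fin 2 × Qubits n)) ℂ) :
    Circuit m n k → Matrix (Reg m n k) (Reg m n k) ℂ
  | [] => 1
  | g :: gs => Circuit.eval UB US gs * g.eval UB US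

/-- The inverse circuit. -/
def Circuit.inv {m n k : ℕ} (c : Circuit m n k) : Circuit m n k := (c.map Gate.inv).reverse

/-- The number of queries made by a circuit. -/
def Circuit.queries {m n k : ℕ} (c : Circuit m n k) : ℕ := (c.map Gate.queries).sum

/-! ### The fixed unitaries -/

theorem multiplexed_mem_unitary {ι D R : Type} [Fintype ι] [DecidableEq ι] [Fintype D]
    [DecidableEq D] [Fintype R] [DecidableEq R] (e : ι ≃ D × R) (f : R → Matrix D D ℂ)
    (hf : ∀ r, f r ∈ Matrix.unitaryGroup D ℂ) :
    multiplexed e f ∈ Matrix.unitaryGroup ι ℂ := by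
  rw [Matrix.mem_unitaryGroup_iff, Matrix.star_eq_conjTranspose, multiplexed,
    Matrix.conjTranspose_submatrix, Matrix.submatrix_mul_equiv, Matrix.blockDiagonal_conjTranspose,
    ← Matrix.blockDiagonal_mul]
  have h : (fun r => f r * (f r)ᴴ) = 1 := by
    funext r
    exact Matrix.mem_unitaryGroup_iff.1 (hf r)
  rw [h, Matrix.blockDiagonal_one, Matrix.submatrix_one_equiv]

theorem hadamard_mem_unitary : hadamard ∈ Matrix.unitaryGroup (Fin 2) ℂ := by
  have h2 : ((Real.sqrt 2 : ℝ) : ℂ) * ((Real.sqrt 2 : ℝ) : ℂ) = 2 := by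
    rw [← Complex.ofReal_mul, Real.mul_self_sqrt (by norm_num)]
    norm_num
  have h0 : ((Real.sqrt 2 : ℝ) : ℂ)⁻¹ * ((Real.sqrt 2 : ℝ) : ℂ)⁻¹ = 1 / 2 := by
    rw [← mul_inv, h2, one_div]
  rw [Matrix.mem_unitaryGroup_iff, Matrix.star_eq_conjTranspose, hadamard]
  ext i j
  fin_cases i <;> fin_cases j <;>
    simp [Matrix.mul_apply, Fin.sum_univ_two, h0] <;> norm_num

/-- The gates on the ancilla qubit selected by the two LCU ancillas: `X, iY, X, -iY` for the real
part and `iX, -Y, -iX, -Y` for the imaginary part. -/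
def selected : Part → Fin 2 × Fin 2 → Matrix (Fin 2) (Fin 2) ℂ
  | .re, l => if l.2 = 0 then pauliX else if l.1 = 0 then Complex.I • pauliY else
      -(Complex.I • pauliY)
  | .im, l => if l.2 = 0 then (if l.1 = 0 then Complex.I • pauliX else -(Complex.I • pauliX)) else
      -pauliY

theorem selected_mem_unitary (p : Part) (l : Fin 2 × Fin 2) :
    selected p l ∈ Matrix.unitaryGroup (Fin 2) ℂ := by
  obtain ⟨a, b⟩ := l
  rw [Matrix.mem_unitaryGroup_iff, Matrix.star_eq_conjTranspose]
  cases p <;> fin_cases a <;> fin_cases b <;> ext i j <;> fin_cases i <;> fin_cases j <;>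
    simp [selected, pauliX, pauliY, Matrix.mul_apply, Fin.sum_univ_two]

/-- Hadamard gates on the control qubit and on the two LCU ancillas. -/
def hadamardGate (m n k : ℕ) : Matrix.unitaryGroup (Reg m n k) ℂ :=
  ⟨multiplexed (regEquivC m n k) (fun _ => hadamard ⊗ₖ (hadamard ⊗ₖ hadamard)),
    multiplexed_mem_unitary _ _ fun _ => Matrix.kronecker_mem_unitary hadamard_mem_unitary
      (Matrix.kronecker_mem_unitary hadamard_mem_unitary hadamard_mem_unitary)⟩

/-- The selected gate on the ancilla qubit, applied if the control qubit is `1`. -/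
def selectGate (m n k : ℕ) (p : Part) : Matrix.unitaryGroup (Reg m n k) ℂ :=
  ⟨multiplexed (regEquivD m n k) (fun r => if r.1 = 1 then selected p r.2.1 else 1),
    multiplexed_mem_unitary _ _ fun r => by
      split_ifs
      · exact selected_mem_unitary p r.2.1
      · exact one_mem _⟩

/-- The reflection `I - 2|0⟩⟨0|` at the all-zero basis state of the whole workspace. -/
def reflectionGate (m n k : ℕ) : Matrix.unitaryGroup (Reg m n k) ℂ :=
  ⟨Matrix.diagonal fun w => if w = 0 then -1 else 1, by
    rw [Matrix.mem_unitaryGroup_iff, Matrix.star_eq_conjTranspose, Matrix.diagonal_conjTranspose,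
      Matrix.diagonal_mul_diagonal, ← Matrix.diagonal_one]
    congr 1
    funext w
    by_cases h : w = 0 <;> simp [h]⟩

/-! ### The circuits of amplitude estimation -/

/-- A circuit for `U_{B,r2}` or `U_{B,i2}`, with one query to `U_B` and one to `U_B†`. -/
def lcuCircuit (m n k : ℕ) (p : Part) : Circuit m n k :=
  [.free (hadamardGate m n k),
   .queryB (fun c => c.1 == 1 && c.2.1 == 0) false,
   .queryB (fun c => c.1 == 1 && c.2.1 == 1) true,
   .free (selectGate m n k p),
   .free (hadamardGate m n k)]

/-- A circuit for the reflection `I - 2|0S0⟩⟨0S0|`. -/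
def reflectCircuit (m n k : ℕ) : Circuit m n k :=
  [.queryS true, .free (reflectionGate m n k), .queryS false]

/-- A circuit for the Grover operator. -/
def groverCircuit (m n k : ℕ) (p : Part) : Circuit m n k :=
  reflectCircuit m n k ++ (lcuCircuit m n k p).inv ++ reflectCircuit m n k ++
    lcuCircuit m n k p ++ [.free (-1)]

/-- The circuit that prepares `|0S0⟩` from the all-zero state, applies `U_{B,r2}` or `U_{B,i2}`,
then the Grover operator `r` times, and then undoes the preparation of `|S_A⟩`. -/
def experiment (m n k : ℕ) (p : Part) (r : ℕ) : Circuit m n k :=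
  [.queryS false] ++ lcuCircuit m n k p ++ (List.replicate r (groverCircuit m n k p)).flatten ++
    [.queryS true]

theorem queries_experiment (m n k : ℕ) (p : Part) (r : ℕ) :
    (experiment m n k p r).queries = 8 * r + 4 := by
  have h : ∀ r : ℕ, ((List.replicate r (groverCircuit m n k p)).flatten.map Gate.queries).sum
      = 8 * r := by
    intro r
    induction r with
    | zero => simp
    | succ r ih =>
      rw [List.replicate_succ, List.flatten_cons, List.map_append, List.sum_append, ih]
      simp [groverCircuit, reflectCircuit, lcuCircuit, Circuit.inv, Gate.inv, Gate.queries]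
      ring
  simp only [experiment, Circuit.queries, List.map_append, List.sum_append, h]
  simp [lcuCircuit, Gate.queries]
  ring

/-- The probability of the all-zero outcome when `experiment m n k p r` is run on the all-zero
state and all qubits are then measured in the computational basis. -/
def zeroProb {m n k : ℕ} (UB : Matrix (Qubits n × Qubits k) (Qubits n × Qubits k) ℂ)
    (US : Matrix (Qubits m × (Fin 2 × Qubits n)) (Qubits m × (Fin 2 × Qubits n)) ℂ)
    (p : Part) (r : ℕ) : ℝ :=
  ‖((experiment m n k p r).eval UB US *ᵥ basisKet 0) 0‖ ^ 2

/-! ### Amplitude estimation as an adaptive procedure -/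

/-- What the classical control does next: run the experiment with `r` Grover iterations and
measure, or stop and output an estimate `a` of the amplitude. -/
inductive Move : Type
  | run (r : ℕ)
  | output (a : ℝ)

/-- The classical control of an amplitude estimation procedure: the next move as a function of the
earlier measurement results, latest first (`true` for the all-zero outcome). -/
abbrev Controller : Type := List Bool → Move

open Classical in
/-- The probability that the procedure, started with the history `h`, makes at most `T` more
queries, stops, and outputs an element of `G`. -/
def successProb {m n k : ℕ} (UB : Matrix (Qubits n × Qubits k) (Qubits n × Qubits k) ℂ)
    (US : Matrix (Qubits m × (Fin 2 × Qubits n)) (Qubits m × (Fin 2 × Qubits n)) ℂ)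
    (p : Part) (ctrl : Controller) (G : Set ℝ) (T : ℕ) (h : List Bool) : ℝ :=
  match ctrl h with
  | .output a => if a ∈ G then 1 else 0
  | .run r =>
    if (experiment m n k p r).queries ≤ T then
      zeroProb UB US p r *
          successProb UB US p ctrl G (T - (experiment m n k p r).queries) (true :: h) +
        (1 - zeroProb UB US p r) *
          successProb UB US p ctrl G (T - (experiment m n k p r).queries) (false :: h)
    else 0
termination_by T
decreasing_by
  all_goals
    have hq := queries_experiment m n k p r
    omega

end

end StateMatrixization

open StateMatrixization

/-!
The expectation `⟨0S0|U_{B,q1}|0S0⟩` equals `x = γ λ μ`: between two Hadamard layers the select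
operator has the block `(|0⟩⟨1| ⊗ U + |1⟩⟨0| ⊗ U†) / 2` (for the real part), which pairs the
off-diagonal block of `ρ_A` with the encoded block of `U_B` (`sum_lcuUnitary`). The controlled
version has amplitude `(1 + x) / 2 ∈ [0, 1]`, which is written `sin θ`. The Grover operator acts as a
rotation by `2θ` in the plane of `|0S0⟩` and `U_{B,q2}|0S0⟩`, so the experiment with `r` iterations
has the result `true` with probability `sin² ((2r + 1) θ)` (`zeroProb_eq`). What remains is a
classical problem: to find `x` up to the relative error `ε` from such coins, where the coin `r`
costs `8r + 4`. For `ε ≥ 1` the output `1/2` is good enough without any query.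

*Additive precision.* Given an interval of width `w` that contains `θ`, there is an odd number
`2r + 1` of order `1 / w` for which the coin `r` distinguishes the two ends of the interval with a
constant gap (`exists_separating_iteration`). Repeated tosses discard one of the ends. Since the
cost per toss grows geometrically as the interval shrinks, early rounds can be repeated more
often, and precision `τ` with failure probability `2 ^ (-L)` costs `O(L / τ)`
(`exists_angle_estimation`).

*Relative precision.* It suffices to know the order of magnitude of the deviation
`φ = θ - π / 6`, which is comparable to `x`, and then to estimate `θ` up to a multiple of `ε |φ|`. The
order of magnitude is found by trying the scales `j = 0, 1, 2, …`. A union bound over scales with a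
fixed number of tosses per scale would fail for a general two-sided test. Here the test is
one-sided: for `2r + 1 = 3 ^ (j + 1)` the coin shows `false` with probability
`sin² (3 ^ (j + 1) φ)`, because `sin² (3 ^ (j + 1) π / 6) = 1`. The probability of stopping too early
thus decays geometrically with the distance from the right scale and is summable
(`succ_scaleSearch_ge`), which gives `O(log (1 / δ) / (ε |x|))` queries without further
logarithmic factors.

Terminating procedures are decision trees (`Program`). The search over scales is unbounded; since
every scale consumes measurement results, its moves after a given history are those of a
sufficiently deep finite tree (`walk_scaleSearch`), and this defines the controller.
-/

namespace StateMatrixization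

/-! ### Multiplexed operators and circuits -/

section Multiplexed

variable {ι D R : Type}

theorem multiplexed_apply [DecidableEq R] (e : ι ≃ D × R) (f : R → Matrix D D ℂ) (i j : ι) :
    multiplexed e f i j = if (e i).2 = (e j).2 then f (e i).2 (e i).1 (e j).1 else 0 := by
  simp [multiplexed, Matrix.blockDiagonal_apply]

theorem multiplexed_mul [Fintype ι] [Fintype D] [Fintype R] [DecidableEq R] (e : ι ≃ D × R)
    (f g : R → Matrix D D ℂ) :
    multiplexed e f * multiplexed e g = multiplexed e (fun r => f r * g r) := by
  rw [multiplexed, multiplexed, multiplexed, Matrix.submatrix_mul_equiv,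
    ← Matrix.blockDiagonal_mul]

theorem multiplexed_conjTranspose [DecidableEq R] (e : ι ≃ D × R) (f : R → Matrix D D ℂ) :
    (multiplexed e f)ᴴ = multiplexed e (fun r => (f r)ᴴ) := by
  rw [multiplexed, multiplexed, Matrix.conjTranspose_submatrix, Matrix.blockDiagonal_conjTranspose]

theorem multiplexed_mul_apply [Fintype ι] [Fintype D] [Fintype R] [DecidableEq R]
    (e : ι ≃ D × R) (f : R → Matrix D D ℂ) {κ : Type} (M : Matrix ι κ ℂ) (i : ι) (j : κ) :
    (multiplexed e f * M) i j =
      ∑ d, f (e i).2 (e i).1 d * M (e.symm (d, (e i).2)) j := by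
  rw [Matrix.mul_apply, ← Equiv.sum_comp e.symm, Fintype.sum_prod_type]
  refine Finset.sum_congr rfl fun d _ => ?_
  simp only [multiplexed_apply, Equiv.apply_symm_apply]
  simp

theorem multiplexed_mulVec [Fintype ι] [Fintype D] [Fintype R] [DecidableEq R]
    (e : ι ≃ D × R) (f : R → Matrix D D ℂ) (v : ι → ℂ) (i : ι) :
    (multiplexed e f *ᵥ v) i = ∑ d, f (e i).2 (e i).1 d * v (e.symm (d, (e i).2)) := by
  simpa [Matrix.mulVec, dotProduct, Matrix.mul_apply] using
    multiplexed_mul_apply e f (Matrix.of fun i (_ : Unit) => v i) i ()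

end Multiplexed

section Circuits

variable {m n k : ℕ} (UB : Matrix (Qubits n × Qubits k) (Qubits n × Qubits k) ℂ)
  (US : Matrix (Qubits m × (Fin 2 × Qubits n)) (Qubits m × (Fin 2 × Qubits n)) ℂ)

theorem Circuit.eval_append (c d : Circuit m n k) :
    Circuit.eval UB US (c ++ d) = Circuit.eval UB US d * Circuit.eval UB US c := by
  induction c with
  | nil => simp [Circuit.eval]
  | cons g c ih => simp only [List.cons_append, Circuit.eval, ih, mul_assoc]

theorem adjointIf_not {Q : Type} (b : Bool) (U : Matrix Q Q ℂ) :
    adjointIf (!b) U = (adjointIf b U)ᴴ := by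
  cases b <;> simp [adjointIf]

theorem Gate.eval_inv (g : Gate m n k) : g.inv.eval UB US = (g.eval UB US)ᴴ := by
  cases g with
  | free V => rfl
  | queryB c adj =>
    simp only [Gate.inv, Gate.eval, multiplexed_conjTranspose]
    congr 1
    funext r
    split_ifs
    · exact adjointIf_not adj UB
    · simp
  | queryS adj => simp only [Gate.inv, Gate.eval, multiplexed_conjTranspose, adjointIf_not]

theorem Circuit.eval_inv (c : Circuit m n k) :
    Circuit.eval UB US c.inv = (Circuit.eval UB US c)ᴴ := by
  induction c with
  | nil => simp [Circuit.inv, Circuit.eval]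
  | cons g c ih =>
    have h : Circuit.inv (g :: c) = Circuit.inv c ++ [g.inv] := by simp [Circuit.inv]
    rw [h, Circuit.eval_append, ih]
    simp [Circuit.eval, Gate.eval_inv, Matrix.conjTranspose_mul]

/-! ### The circuit for the controlled LCU unitary -/

theorem hadamard_mul_self : hadamard * hadamard = 1 := by
  have h := Matrix.mem_unitaryGroup_iff.1 hadamard_mem_unitary
  have h2 : star hadamard = hadamard := by
    rw [Matrix.star_eq_conjTranspose, hadamard]
    ext i j
    fin_cases i <;> fin_cases j <;> simp
  rwa [h2] at h

/-- The LCU select operator is block diagonal in the two ancillas: the gate `selected p l` on the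
ancilla qubit and `U` or `U†`, depending on the first LCU ancilla, on the system. -/
theorem lcuSelect_apply {Q : Type} (U : Matrix Q Q ℂ) (p : Part) (l l' : Fin 2 × Fin 2)
    (d d' : Fin 2) (q q' : Q) :
    lcuSelect U p (l, (d, q)) (l', (d', q')) =
      if l = l' then selected p l d d' * adjointIf (l.1 == 1) U q q' else 0 := by
  obtain ⟨a, b⟩ := l
  obtain ⟨a', b'⟩ := l'
  cases p <;> fin_cases a <;> fin_cases b <;> fin_cases a' <;> fin_cases b' <;>
    simp [lcuSelect, selected, adjointIf, proj, mul_assoc]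

theorem multiplexed_lcuSelect (p : Part) :
    (selectGate m n k p : Matrix (Reg m n k) (Reg m n k) ℂ) *
      ((Gate.queryB (fun c => c.1 == 1 && c.2.1 == 1) true : Gate m n k).eval UB US *
        (Gate.queryB (fun c => c.1 == 1 && c.2.1 == 0) false : Gate m n k).eval UB US) =
    proj 0 ⊗ₖ 1 + proj 1 ⊗ₖ
      multiplexed (lcuEquiv (Fin 2 × Fin 2) (Qubits m) (Fin 2 × (Qubits n × Qubits k)))
        (fun _ => lcuSelect UB p) := by
  ext ⟨c, l, M, d, q⟩ ⟨c', l', M', d', q'⟩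
  simp only [Gate.eval, multiplexed_mul]
  rw [selectGate, multiplexed_mul_apply]
  simp only [multiplexed_apply, regEquivD, regEquivB, lcuEquiv, Equiv.coe_fn_mk,
    Equiv.coe_fn_symm_mk, Matrix.add_apply, Matrix.kroneckerMap_apply, lcuSelect_apply, proj,
    Matrix.single_apply, Matrix.one_apply, Prod.mk.injEq]
  obtain ⟨l1, l2⟩ := l
  fin_cases c <;> fin_cases c' <;> fin_cases l1 <;>
    simp [adjointIf, Matrix.one_apply, Fin.sum_univ_two]
  all_goals
    fin_cases d <;> fin_cases d' <;>
      simp only [Fin.zero_eta, Fin.mk_one, Fin.isValue, zero_ne_one, one_ne_zero, if_true, if_false,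
        and_true, and_false, true_and, false_and, zero_add, add_zero, ite_self] <;>
      split_ifs <;> simp_all

theorem eval_lcuCircuit (p : Part) :
    Circuit.eval UB US (lcuCircuit m n k p) = ctrlLCU m UB p := by
  have hh : (hadamard ⊗ₖ hadamard) * (hadamard ⊗ₖ hadamard) = 1 := by
    rw [← Matrix.mul_kronecker_mul, hadamard_mul_self, Matrix.one_kronecker_one]
  -- Hadamard gates on the two LCU ancillas, acting on everything but the control qubit
  set K : Matrix ((Fin 2 × Fin 2) × (Qubits m × (Fin 2 × (Qubits n × Qubits k))))
    ((Fin 2 × Fin 2) × (Qubits m × (Fin 2 × (Qubits n × Qubits k)))) ℂ :=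
    (hadamard ⊗ₖ hadamard) ⊗ₖ 1 with hK
  have hKK : K * K = 1 := by
    rw [hK, ← Matrix.mul_kronecker_mul, hh, one_mul, Matrix.one_kronecker_one]
    congr!
  have hKm : K = multiplexed
      (lcuEquiv (Fin 2 × Fin 2) (Qubits m) (Fin 2 × (Qubits n × Qubits k)))
      (fun _ => (hadamard ⊗ₖ hadamard) ⊗ₖ 1) := by
    ext ⟨l, M, x⟩ ⟨l', M', x'⟩
    simp only [hK, multiplexed_apply, lcuEquiv, Equiv.coe_fn_mk, Matrix.kroneckerMap_apply,
      Matrix.one_apply, Prod.mk.injEq]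
    by_cases hM : M = M' <;> simp [hM]
  have hG : (hadamardGate m n k : Matrix (Reg m n k) (Reg m n k) ℂ) = hadamard ⊗ₖ K := by
    ext ⟨c, l, x⟩ ⟨c', l', x'⟩
    simp only [hadamardGate, hK, multiplexed_apply, regEquivC, Equiv.coe_fn_mk,
      Matrix.kroneckerMap_apply, Matrix.one_apply]
    by_cases hx : x = x' <;> simp [hx]
  have hL : multiplexed (lcuEquiv (Fin 2 × Fin 2) (Qubits m) (Fin 2 × (Qubits n × Qubits k)))
      (fun _ => lcuUnitary UB p) = K *
      multiplexed (lcuEquiv (Fin 2 × Fin 2) (Qubits m) (Fin 2 × (Qubits n × Qubits k)))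
        (fun _ => lcuSelect UB p) * K := by
    rw [hKm, multiplexed_mul, multiplexed_mul]
    rfl
  have hG1 : hadamard ⊗ₖ K = (hadamard ⊗ₖ 1) * ((1 : Matrix (Fin 2) (Fin 2) ℂ) ⊗ₖ K) := by
    rw [← Matrix.mul_kronecker_mul, mul_one, one_mul]
  have hG2 : hadamard ⊗ₖ K = ((1 : Matrix (Fin 2) (Fin 2) ℂ) ⊗ₖ K) * (hadamard ⊗ₖ 1) := by
    rw [← Matrix.mul_kronecker_mul, mul_one, one_mul]
  have hev : Circuit.eval UB US (lcuCircuit m n k p) =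
      (hadamard ⊗ₖ K) * ((selectGate m n k p : Matrix (Reg m n k) (Reg m n k) ℂ) *
      ((Gate.queryB (fun c => c.1 == 1 && c.2.1 == 1) true : Gate m n k).eval UB US *
        (Gate.queryB (fun c => c.1 == 1 && c.2.1 == 0) false : Gate m n k).eval UB US)) *
      (hadamard ⊗ₖ K) := by
    rw [← hG]
    simp only [lcuCircuit, Circuit.eval, one_mul, mul_assoc]
    rfl
  have hmid : ((1 : Matrix (Fin 2) (Fin 2) ℂ) ⊗ₖ K) * (proj 0 ⊗ₖ 1 + proj 1 ⊗ₖ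
      multiplexed (lcuEquiv (Fin 2 × Fin 2) (Qubits m) (Fin 2 × (Qubits n × Qubits k)))
        (fun _ => lcuSelect UB p)) * ((1 : Matrix (Fin 2) (Fin 2) ℂ) ⊗ₖ K) =
      proj 0 ⊗ₖ 1 + proj 1 ⊗ₖ
      multiplexed (lcuEquiv (Fin 2 × Fin 2) (Qubits m) (Fin 2 × (Qubits n × Qubits k)))
        (fun _ => lcuUnitary UB p) := by
    rw [mul_add, add_mul, ← Matrix.mul_kronecker_mul, ← Matrix.mul_kronecker_mul,
      ← Matrix.mul_kronecker_mul, ← Matrix.mul_kronecker_mul, hL]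
    simp only [one_mul, mul_one, hKK]
  rw [hev, multiplexed_lcuSelect, ctrlLCU, ← hmid]
  nth_rewrite 1 [hG1]
  rw [hG2]
  simp only [mul_assoc]

/-! ### The circuit for the Grover operator -/

theorem ketbra_mulVec {ι : Type} [Fintype ι] (U : Matrix ι ι ℂ) (v : Ket ι) :
    ketbra (U *ᵥ v) = U * ketbra v * Uᴴ := by
  rw [ketbra, ketbra, Matrix.mul_vecMulVec, Matrix.vecMulVec_mul, Matrix.star_mulVec]

theorem reflectionGate_eq :
    (reflectionGate m n k : Matrix (Reg m n k) (Reg m n k) ℂ) =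
      1 - (2 : ℂ) • ketbra (basisKet 0) := by
  ext i j
  simp only [reflectionGate, ketbra, basisKet, Matrix.diagonal_apply, Matrix.sub_apply,
    Matrix.one_apply, Matrix.smul_apply, Matrix.vecMulVec_apply, Pi.star_apply, Pi.single_apply]
  by_cases hi : i = 0
  · by_cases hj : j = 0
    · simp [hi, hj]; norm_num
    · have : (0 : Reg m n k) ≠ j := fun h => hj h.symm
      simp [hi, hj, this]
  · simp [hi]

theorem queryS_mulVec_basisKet :
    (Gate.queryS false : Gate m n k).eval UB US *ᵥ basisKet 0 =
      initKet k (US *ᵥ basisKet 0) := by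
  funext ⟨c, l, M, d, q, a⟩
  simp only [Gate.eval, multiplexed_mulVec]
  simp only [initKet, regEquivS, Equiv.coe_fn_mk,
    Equiv.coe_fn_symm_mk, Matrix.mulVec, dotProduct, adjointIf, basisKet, Pi.single_apply]
  by_cases h : c = 0 ∧ l = 0 ∧ a = 0
  · rw [if_pos h]
    obtain ⟨rfl, rfl, rfl⟩ := h
    refine Finset.sum_congr rfl fun x _ => ?_
    congr 2
    obtain ⟨x1, x2, x3⟩ := x
    simp only [Prod.ext_iff, Prod.fst_zero, Prod.snd_zero, eq_iff_iff]
    tauto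
  · rw [if_neg h]
    refine Finset.sum_eq_zero fun x _ => ?_
    refine mul_eq_zero_of_right _ (if_neg fun h0 => ?_)
    simp only [Prod.ext_iff, Prod.fst_zero, Prod.snd_zero] at h0
    exact h ⟨h0.1, Prod.ext h0.2.1.1 h0.2.1.2, h0.2.2.2.2.2⟩

theorem queryS_mul_adjoint
    (hUS : US ∈ Matrix.unitaryGroup (Qubits m × (Fin 2 × Qubits n)) ℂ) :
    (Gate.queryS false : Gate m n k).eval UB US * (Gate.queryS true : Gate m n k).eval UB US = 1 := by
  have h := multiplexed_mem_unitary (regEquivS m n k) (fun _ => US) fun _ => hUS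
  rw [Matrix.mem_unitaryGroup_iff, Matrix.star_eq_conjTranspose, multiplexed_conjTranspose] at h
  exact h

theorem queryS_true_eq : (Gate.queryS true : Gate m n k).eval UB US =
    ((Gate.queryS false : Gate m n k).eval UB US)ᴴ := by
  rw [← Gate.eval_inv]
  rfl

theorem eval_reflectCircuit {S : Ket (Qubits m × (Fin 2 × Qubits n))}
    (hUS : US ∈ Matrix.unitaryGroup (Qubits m × (Fin 2 × Qubits n)) ℂ)
    (hS : US *ᵥ basisKet 0 = S) :
    Circuit.eval UB US (reflectCircuit m n k) = 1 - (2 : ℂ) • ketbra (initKet k S) := by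
  have h1 : (Gate.free (reflectionGate m n k)).eval UB US = 1 - (2 : ℂ) • ketbra (basisKet 0) :=
    reflectionGate_eq
  simp only [reflectCircuit, Circuit.eval, one_mul]
  rw [h1, mul_sub, mul_one, sub_mul, queryS_mul_adjoint UB US hUS, queryS_true_eq, mul_smul_comm,
    smul_mul_assoc, ← ketbra_mulVec, queryS_mulVec_basisKet, hS]

theorem ctrlLCU_mem_unitary (hUB : UB ∈ Matrix.unitaryGroup (Qubits n × Qubits k) ℂ) (p : Part) :
    ctrlLCU m UB p ∈ Matrix.unitaryGroup (Reg m n k) ℂ := by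
  have hadj : UBᴴ ∈ Matrix.unitaryGroup (Qubits n × Qubits k) ℂ := Unitary.star_mem hUB
  have hB : ∀ c adj, (Gate.queryB c adj : Gate m n k).eval UB 1 ∈
      Matrix.unitaryGroup (Reg m n k) ℂ := by
    intro c adj
    refine multiplexed_mem_unitary _ _ fun r => ?_
    split_ifs
    · cases adj
      · exact hUB
      · exact hadj
    · exact one_mem _
  rw [← eval_lcuCircuit UB 1 p]
  simp only [lcuCircuit, Circuit.eval, one_mul]
  exact mul_mem (mul_mem (mul_mem (mul_mem (hadamardGate m n k).2 (selectGate m n k p).2)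
    (hB _ _)) (hB _ _)) (hadamardGate m n k).2

theorem eval_groverCircuit {S : Ket (Qubits m × (Fin 2 × Qubits n))}
    (hUB : UB ∈ Matrix.unitaryGroup (Qubits n × Qubits k) ℂ)
    (hUS : US ∈ Matrix.unitaryGroup (Qubits m × (Fin 2 × Qubits n)) ℂ)
    (hS : US *ᵥ basisKet 0 = S) (p : Part) :
    Circuit.eval UB US (groverCircuit m n k p) = groverOp UB S p := by
  have hu : ctrlLCU m UB p * (ctrlLCU m UB p)ᴴ = 1 :=
    Matrix.mem_unitaryGroup_iff.1 (ctrlLCU_mem_unitary UB hUB p)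
  have h1 : Circuit.eval UB US ([.free (-1)] : Circuit m n k) = -1 := by
    simp only [Circuit.eval, Gate.eval, one_mul]
    rfl
  simp only [groverCircuit, Circuit.eval_append, Circuit.eval_inv, eval_lcuCircuit,
    eval_reflectCircuit UB US hUS hS, h1]
  have h2 : ctrlLCU m UB p * (1 - (2 : ℂ) • ketbra (initKet k S)) * (ctrlLCU m UB p)ᴴ =
      1 - (2 : ℂ) • (ctrlLCU m UB p * ketbra (initKet k S) * (ctrlLCU m UB p)ᴴ) := by
    rw [mul_sub, mul_one, sub_mul, hu, mul_smul_comm, smul_mul_assoc]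
  rw [groverOp, ← h2, neg_one_mul]
  simp only [mul_assoc]

theorem eval_experiment {S : Ket (Qubits m × (Fin 2 × Qubits n))}
    (hUB : UB ∈ Matrix.unitaryGroup (Qubits n × Qubits k) ℂ)
    (hUS : US ∈ Matrix.unitaryGroup (Qubits m × (Fin 2 × Qubits n)) ℂ)
    (hS : US *ᵥ basisKet 0 = S) (p : Part) (r : ℕ) :
    (experiment m n k p r).eval UB US =
      (Gate.queryS true : Gate m n k).eval UB US * groverOp UB S p ^ r *
        ctrlLCU m UB p * (Gate.queryS false : Gate m n k).eval UB US := by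
  have hr : ∀ r : ℕ, Circuit.eval UB US (List.replicate r (groverCircuit m n k p)).flatten =
      groverOp UB S p ^ r := by
    intro r
    induction r with
    | zero => simp [Circuit.eval]
    | succ r ih =>
      rw [List.replicate_succ, List.flatten_cons, Circuit.eval_append, ih,
        eval_groverCircuit UB US hUB hUS hS, pow_succ]
  simp only [experiment, Circuit.eval_append, hr, eval_lcuCircuit]
  simp only [Circuit.eval, one_mul, mul_assoc]

end Circuits

/-! ### The Grover rotation -/

section Braket

variable {ι : Type} [Fintype ι]

theorem braket_add (φ ψ χ : Ket ι) : braket φ (ψ + χ) = braket φ ψ + braket φ χ :=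
  dotProduct_add _ _ _

theorem braket_smul (φ ψ : Ket ι) (c : ℂ) : braket φ (c • ψ) = c * braket φ ψ :=
  dotProduct_smul _ _ _

theorem braket_sub (φ ψ χ : Ket ι) : braket φ (ψ - χ) = braket φ ψ - braket φ χ :=
  dotProduct_sub _ _ _

theorem star_braket (φ ψ : Ket ι) : star (braket φ ψ) = braket ψ φ := by
  rw [braket, braket, Matrix.star_dotProduct, dotProduct_comm]
  simp

theorem braket_mulVec (U : Matrix ι ι ℂ) (φ ψ : Ket ι) :
    braket φ (U *ᵥ ψ) = braket (Uᴴ *ᵥ φ) ψ := by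
  rw [braket, braket, Matrix.star_mulVec, Matrix.conjTranspose_conjTranspose,
    Matrix.dotProduct_mulVec]

theorem ketbra_mulVec_eq (φ ψ : Ket ι) : ketbra φ *ᵥ ψ = braket φ ψ • φ := by
  funext i
  simp only [ketbra, Matrix.vecMulVec_mulVec, braket, Pi.smul_apply, smul_eq_mul]
  simp [mul_comm]

theorem braket_unitary [DecidableEq ι] {U : Matrix ι ι ℂ} (hU : U ∈ Matrix.unitaryGroup ι ℂ)
    (φ : Ket ι) : braket (U *ᵥ φ) (U *ᵥ φ) = braket φ φ := by
  have h : Uᴴ * U = 1 := Matrix.mem_unitaryGroup_iff'.1 hU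
  rw [braket_mulVec, Matrix.mulVec_mulVec, h, Matrix.one_mulVec]

theorem braket_self_nonneg (φ : Ket ι) : 0 ≤ (braket φ φ).re := by
  have h : (0 : ℂ) ≤ braket φ φ := dotProduct_star_self_nonneg _
  exact (Complex.le_def.1 h).1

/-- A unitary with real expectation value `x` in a pure state has `|x| ≤ 1`: this is
positivity of `‖Uφ ± φ‖²`. -/
theorem abs_le_one_of_braket_unitary [DecidableEq ι] {U : Matrix ι ι ℂ}
    (hU : U ∈ Matrix.unitaryGroup ι ℂ) {φ : Ket ι} (hφ : IsPureState φ) {x : ℝ}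
    (hx : braket φ (U *ᵥ φ) = x) : |x| ≤ 1 := by
  have hφ' : braket φ φ = 1 := hφ
  have h1 := braket_unitary hU φ
  have h2 : braket (U *ᵥ φ) φ = x := by rw [← star_braket, hx]; simp
  have key : ∀ c : ℝ, c * c = 1 → 0 ≤ 2 + 2 * (c * x) := by
    intro c hc
    have h := braket_self_nonneg (U *ᵥ φ + (c : ℂ) • φ)
    have e : braket (U *ᵥ φ + (c : ℂ) • φ) (U *ᵥ φ + (c : ℂ) • φ) =
        ((2 + 2 * (c * x) : ℝ) : ℂ) := by
      rw [braket_add, braket_smul, ← star_braket (U *ᵥ φ), ← star_braket φ, braket_add,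
        braket_add, braket_smul, braket_smul, hx, h2, h1, hφ']
      have hc' : (c : ℂ) * c = 1 := by exact_mod_cast hc
      simp
      linear_combination hc'
    rw [e, Complex.ofReal_re] at h
    exact h
  rw [abs_le]
  constructor
  · have := key 1 (by norm_num); linarith
  · have := key (-1) (by norm_num); linarith

/-- In the plane of `s` and `u`, the Grover operator is a rotation by twice the angle `θ` with
`sin θ = ⟨s|u⟩`. The two amplitudes are computed together by induction. -/
theorem braket_grover_pow [DecidableEq ι] {s u : Ket ι} (hs : IsPureState s) (hu : IsPureState u)
    {θ : ℝ} (hsu : braket s u = Real.sin θ) (r : ℕ) :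
    braket s ((-((1 - (2 : ℂ) • ketbra u) * (1 - (2 : ℂ) • ketbra s))) ^ r *ᵥ u) =
        Real.sin ((2 * r + 1) * θ) ∧
      braket s ((-((1 - (2 : ℂ) • ketbra u) * (1 - (2 : ℂ) • ketbra s))) ^ r *ᵥ s) =
        Real.cos (2 * r * θ) := by
  set G := -((1 - (2 : ℂ) • ketbra u) * (1 - (2 : ℂ) • ketbra s)) with hG
  have hs' : braket s s = 1 := hs
  have hu' : braket u u = 1 := hu
  have hus : braket u s = Real.sin θ := by
    rw [← star_braket, hsu]
    exact Complex.conj_ofReal _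
  have refl_apply : ∀ v w : Ket ι, (1 - (2 : ℂ) • ketbra v) *ᵥ w = w - (2 * braket v w) • v := by
    intro v w
    rw [Matrix.sub_mulVec, Matrix.one_mulVec, Matrix.smul_mulVec, ketbra_mulVec_eq, smul_smul]
  have hGs : G *ᵥ s = s - (2 * (Real.sin θ : ℂ)) • u := by
    rw [hG, Matrix.neg_mulVec, ← Matrix.mulVec_mulVec, refl_apply s, hs', Matrix.mulVec_sub,
      Matrix.mulVec_smul, refl_apply, hus]
    module
  have hGu : G *ᵥ u = (1 - 4 * (Real.sin θ : ℂ) ^ 2) • u + (2 * (Real.sin θ : ℂ)) • s := by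
    rw [hG, Matrix.neg_mulVec, ← Matrix.mulVec_mulVec, refl_apply s, hsu, Matrix.mulVec_sub,
      Matrix.mulVec_smul, refl_apply, refl_apply, hus, hu']
    module
  induction r with
  | zero => simp [hsu, hs']
  | succ r ih =>
    obtain ⟨ih1, ih2⟩ := ih
    rw [pow_succ, ← Matrix.mulVec_mulVec, ← Matrix.mulVec_mulVec, hGs, hGu, Matrix.mulVec_add,
      Matrix.mulVec_sub, Matrix.mulVec_smul, Matrix.mulVec_smul, Matrix.mulVec_smul, braket_add,
      braket_sub, braket_smul, braket_smul, braket_smul, ih1, ih2]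
    constructor
    · norm_cast
      push_cast
      have e1 : (2 * ((r : ℝ) + 1) + 1) * θ = 2 * r * θ + θ + 2 * θ := by ring
      have e2 : (2 * (r : ℝ) + 1) * θ = 2 * r * θ + θ := by ring
      rw [e1, e2, Real.sin_add (2 * r * θ + θ), Real.sin_add (2 * r * θ), Real.cos_add,
        Real.sin_two_mul, Real.cos_two_mul]
      have := Real.sin_sq_add_cos_sq θ
      linear_combination (-2 * Real.sin (2 * r * θ) * Real.cos θ) * this +
        (-4 * Real.cos (2 * r * θ) * Real.sin θ) * this
    · norm_cast
      push_cast
      have e1 : 2 * ((r : ℝ) + 1) * θ = 2 * r * θ + 2 * θ := by ring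
      have e2 : (2 * (r : ℝ) + 1) * θ = 2 * r * θ + θ := by ring
      rw [e1, e2, Real.sin_add, Real.cos_add, Real.sin_two_mul, Real.cos_two_mul]
      have := Real.sin_sq_add_cos_sq θ
      linear_combination (-2 * Real.cos (2 * r * θ)) * this

end Braket

/-! ### The amplitude -/

section Amplitude

variable {m n k : ℕ}

theorem initKet_regEquivS_symm (S : Ket (Qubits m × (Fin 2 × Qubits n)))
    (x : Qubits m × (Fin 2 × Qubits n)) (r : Fin 2 × (Fin 2 × Fin 2) × Qubits k) :
    initKet k S ((regEquivS m n k).symm (x, r)) = if r = 0 then S x else 0 := by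
  obtain ⟨c, l, a⟩ := r
  simp only [initKet, regEquivS, Equiv.coe_fn_symm_mk, Prod.mk_eq_zero]
  rfl

theorem braket_initKet (S : Ket (Qubits m × (Fin 2 × Qubits n))) (v : Ket (Reg m n k)) :
    braket (initKet k S) v = ∑ x, star (S x) * v ((regEquivS m n k).symm (x, 0)) := by
  rw [braket, dotProduct, ← Equiv.sum_comp (regEquivS m n k).symm, Fintype.sum_prod_type]
  refine Finset.sum_congr rfl fun x _ => ?_
  rw [Finset.sum_eq_single 0]
  · simp [initKet_regEquivS_symm]
  · intro r _ hr
    simp [initKet_regEquivS_symm, hr]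
  · simp

theorem mulVec_initKet (S : Ket (Qubits m × (Fin 2 × Qubits n)))
    (M : Matrix (Reg m n k) (Reg m n k) ℂ) (i : Reg m n k) :
    (M *ᵥ initKet k S) i = ∑ x, M i ((regEquivS m n k).symm (x, 0)) * S x := by
  rw [Matrix.mulVec, dotProduct, ← Equiv.sum_comp (regEquivS m n k).symm, Fintype.sum_prod_type]
  refine Finset.sum_congr rfl fun x _ => ?_
  rw [Finset.sum_eq_single 0]
  · simp [initKet_regEquivS_symm]
  · intro r _ hr
    simp [initKet_regEquivS_symm, hr]
  · simp

theorem isPureState_initKet {S : Ket (Qubits m × (Fin 2 × Qubits n))}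
    {ρ : Matrix (Fin 2 × Qubits n) (Fin 2 × Qubits n) ℂ} (hρ : ρ.trace = 1)
    (hS : IsPurification S ρ) : IsPureState (initKet k S) := by
  rw [IsPureState, braket_initKet, ← hρ, ← hS]
  simp only [initKet_regEquivS_symm, if_true, Matrix.trace, Matrix.diag, partialTraceFst, ketbra,
    Matrix.of_apply, Matrix.vecMulVec_apply, Pi.star_apply]
  rw [Fintype.sum_prod_type, Finset.sum_comm]
  simp only [mul_comm]

theorem inv_sqrt_two_mul_self :
    ((Real.sqrt 2 : ℝ) : ℂ)⁻¹ * ((Real.sqrt 2 : ℝ) : ℂ)⁻¹ = 1 / 2 := by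
  rw [← mul_inv, ← Complex.ofReal_mul, Real.mul_self_sqrt (by norm_num)]
  norm_num

theorem ctrlLCU_apply_zero (UB : Matrix (Qubits n × Qubits k) (Qubits n × Qubits k) ℂ) (p : Part)
    (w w' : (Fin 2 × Fin 2) × (Qubits m × (Fin 2 × (Qubits n × Qubits k)))) :
    ctrlLCU m UB p (0, w) (0, w') = 1 / 2 * ((1 : Matrix _ _ ℂ) w w' +
      multiplexed (lcuEquiv (Fin 2 × Fin 2) (Qubits m) (Fin 2 × (Qubits n × Qubits k)))
        (fun _ => lcuUnitary UB p) w w') := by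
  have h : ∀ i : Fin 2, (hadamard * proj i * hadamard) 0 0 = 1 / 2 := by
    intro i
    rw [← inv_sqrt_two_mul_self]
    simp only [Matrix.mul_apply, Fin.sum_univ_two, hadamard, proj, Matrix.smul_apply,
      Matrix.single_apply]
    fin_cases i <;> simp
  rw [ctrlLCU, mul_add, add_mul]
  simp only [← Matrix.mul_kronecker_mul, one_mul, mul_one, Matrix.add_apply,
    Matrix.kroneckerMap_apply, h]
  ring

theorem lcuUnitary_apply_zero {Q : Type} [Fintype Q] [DecidableEq Q] (U : Matrix Q Q ℂ) (p : Part)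
    (d d' : Fin 2) (q q' : Q) :
    lcuUnitary U p ((0 : Fin 2 × Fin 2), (d, q)) ((0 : Fin 2 × Fin 2), (d', q')) =
      1 / 4 * ∑ l, selected p l d d' * adjointIf (l.1 == 1) U q q' := by
  have hl : ∀ l : Fin 2 × Fin 2,
      hadamard (0 : Fin 2 × Fin 2).1 l.1 * hadamard (0 : Fin 2 × Fin 2).2 l.2 = 1 / 2 := by
    rintro ⟨a, b⟩
    rw [← inv_sqrt_two_mul_self]
    fin_cases a <;> fin_cases b <;> simp [hadamard]
  have hr : ∀ l : Fin 2 × Fin 2,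
      hadamard l.1 (0 : Fin 2 × Fin 2).1 * hadamard l.2 (0 : Fin 2 × Fin 2).2 = 1 / 2 := by
    rintro ⟨a, b⟩
    rw [← inv_sqrt_two_mul_self]
    fin_cases a <;> fin_cases b <;> simp [hadamard]
  rw [lcuUnitary, Matrix.mul_apply, Fintype.sum_prod_type, Finset.mul_sum]
  refine Finset.sum_congr rfl fun l _ => ?_
  rw [Finset.sum_eq_single (d', q')]
  · rw [Matrix.mul_apply, Fintype.sum_prod_type, Finset.sum_eq_single l]
    · rw [Finset.sum_eq_single (d, q)]
      · simp only [Matrix.kroneckerMap_apply, hl, hr, Matrix.one_apply_eq, lcuSelect_apply,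
          if_true]
        ring
      · intro x _ hx
        simp [Matrix.kroneckerMap_apply, Matrix.one_apply_ne hx.symm]
      · simp
    · intro l' _ hl'
      refine Finset.sum_eq_zero fun x _ => ?_
      rw [lcuSelect_apply, if_neg hl', mul_zero]
    · simp
  · intro x _ hx
    simp [Matrix.kroneckerMap_apply, Matrix.one_apply_ne hx]
  · simp

/-- The value of `⟨0S0|U_{B,r1}|0S0⟩`: the LCU unitary has the block `(|0⟩⟨1| ⊗ U + |1⟩⟨0| ⊗ U†) / 2`
(for the real part), and the expectation of this block in `ρ` pairs the two encodings. -/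
theorem sum_lcuUnitary {lam γ : ℝ} {A B : Ket (Qubits n × Qubits n)}
    {UB : Matrix (Qubits n × Qubits k) (Qubits n × Qubits k) ℂ}
    {ρA : Matrix (Fin 2 × Qubits n) (Fin 2 × Qubits n) ℂ}
    {SA : Ket (Qubits m × (Fin 2 × Qubits n))} (hB : IsUBSE UB lam B) (hA : IsDMSE ρA 0 1 γ A)
    (hS : IsPurification SA ρA) (p : Part) :
    ∑ x : Qubits m × (Fin 2 × Qubits n), star (SA x) * ∑ x' : Qubits m × (Fin 2 × Qubits n),
      multiplexed (lcuEquiv (Fin 2 × Fin 2) (Qubits m) (Fin 2 × (Qubits n × Qubits k)))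
        (fun _ => lcuUnitary UB p) (0, (x.1, (x.2.1, (x.2.2, 0))))
        (0, (x'.1, (x'.2.1, (x'.2.2, 0)))) * SA x' = ((γ * lam * p.of (braket B A) : ℝ) : ℂ) := by
  have hBe : ∀ i j, UB (i, 0) (j, 0) = lam * B (i, j) := fun i j => congrFun hB.2.2.2 (i, j)
  have hAe : ∀ i j, ∑ M, SA (M, (0, i)) * star (SA (M, (1, j))) = γ * A (i, j) := by
    intro i j
    have h := congrFun hA.2.2.2.2 (i, j)
    rw [← hS] at h
    exact h
  have hAe' : ∀ i j, ∑ M, star (SA (M, (0, i))) * SA (M, (1, j)) = γ * star (A (i, j)) := by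
    intro i j
    have h := congrArg star (hAe i j)
    rw [star_sum] at h
    simpa [mul_comm] using h
  -- the coefficient of `|0⟩⟨1| ⊗ U` in the block of the LCU unitary
  set cp : ℂ := match p with
    | .re => 1 / 2
    | .im => Complex.I / 2 with hcp
  have hent : ∀ (d d' : Fin 2) (i j : Qubits n),
      lcuUnitary UB p ((0 : Fin 2 × Fin 2), (d, (i, (0 : Qubits k)))) (0, (d', (j, 0))) =
      if d = 0 ∧ d' = 1 then cp * (lam * B (i, j)) else
        if d = 1 ∧ d' = 0 then star cp * (lam * star (B (j, i))) else 0 := by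
    intro d d' i j
    rw [lcuUnitary_apply_zero, Fintype.sum_prod_type, ← hBe, ← Complex.conj_ofReal lam,
      ← Complex.star_def, ← star_mul', ← hBe]
    cases p <;> fin_cases d <;> fin_cases d' <;>
      simp [selected, adjointIf, Fin.sum_univ_two, pauliX, pauliY, hcp] <;> ring
  have hof : ((p.of (braket B A) : ℝ) : ℂ) = cp * braket A B + star cp * braket B A := by
    rw [← star_braket B A]
    cases p
    · simp only [Part.of, hcp]
      apply Complex.ext <;> simp
      ring
    · simp only [Part.of, hcp]
      apply Complex.ext <;> simp <;> ring
  have hsum : ∀ (M : Qubits m) (d : Fin 2) (i : Qubits n),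
      ∑ x' : Qubits m × (Fin 2 × Qubits n),
      multiplexed (lcuEquiv (Fin 2 × Fin 2) (Qubits m) (Fin 2 × (Qubits n × Qubits k)))
        (fun _ => lcuUnitary UB p) (0, (M, (d, (i, 0))))
        (0, (x'.1, (x'.2.1, (x'.2.2, 0)))) * SA x' =
      ∑ d', ∑ j, lcuUnitary UB p ((0 : Fin 2 × Fin 2), (d, (i, (0 : Qubits k)))) (0, (d', (j, 0)))
        * SA (M, (d', j)) := by
    intro M d i
    rw [Fintype.sum_prod_type, Finset.sum_eq_single M, Fintype.sum_prod_type]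
    · simp [multiplexed_apply, lcuEquiv]
    · intro M' _ hM
      simp [multiplexed_apply, lcuEquiv, hM.symm]
    · simp
  rw [Fintype.sum_prod_type]
  simp only [hsum, hent, Fintype.sum_prod_type, Fin.sum_univ_two]
  simp only [Fin.isValue, zero_ne_one, one_ne_zero, and_false, and_true, if_true, if_false,
    zero_mul, Finset.sum_const_zero, zero_add, add_zero, Finset.sum_add_distrib,
    Finset.mul_sum]
  push_cast
  rw [hof, mul_add]
  congr 1
  · rw [Finset.sum_comm]
    simp only [braket, dotProduct, Fintype.sum_prod_type, Finset.mul_sum, Pi.star_apply]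
    refine Finset.sum_congr rfl fun i _ => ?_
    rw [Finset.sum_comm]
    refine Finset.sum_congr rfl fun j _ => ?_
    have e : ∀ M, star (SA (M, (0, i))) * (cp * (lam * B (i, j)) * SA (M, (1, j))) =
        (star (SA (M, (0, i))) * SA (M, (1, j))) * (cp * (lam * B (i, j))) := fun M => by ring
    simp only [e, ← Finset.sum_mul, hAe']
    ring
  · rw [Finset.sum_comm]
    simp only [braket, dotProduct, Fintype.sum_prod_type, Finset.mul_sum, Pi.star_apply]
    rw [Finset.sum_comm (γ := Qubits n) (f := fun x y => _ * (_ * (star (B (x, y)) * _)))]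
    refine Finset.sum_congr rfl fun i _ => ?_
    rw [Finset.sum_comm]
    refine Finset.sum_congr rfl fun j _ => ?_
    have e : ∀ M, star (SA (M, (1, i))) * (star cp * (lam * star (B (j, i))) * SA (M, (0, j))) =
        (SA (M, (0, j)) * star (SA (M, (1, i)))) * (star cp * (lam * star (B (j, i)))) :=
      fun M => by ring
    simp only [e, ← Finset.sum_mul, hAe]
    ring

theorem lcuUnitary_mem_unitary {Q : Type} [Fintype Q] [DecidableEq Q] {U : Matrix Q Q ℂ}
    (hU : U ∈ Matrix.unitaryGroup Q ℂ) (p : Part) :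
    lcuUnitary U p ∈ Matrix.unitaryGroup ((Fin 2 × Fin 2) × (Fin 2 × Q)) ℂ := by
  have hs : lcuSelect U p = multiplexed (Equiv.prodComm _ _)
      (fun l : Fin 2 × Fin 2 => selected p l ⊗ₖ adjointIf (l.1 == 1) U) := by
    ext ⟨l, d, q⟩ ⟨l', d', q'⟩
    rw [lcuSelect_apply, multiplexed_apply]
    rfl
  have hsel : lcuSelect U p ∈ Matrix.unitaryGroup ((Fin 2 × Fin 2) × (Fin 2 × Q)) ℂ := by
    rw [hs]
    refine multiplexed_mem_unitary _ _ fun l =>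
      Matrix.kronecker_mem_unitary (selected_mem_unitary p l) ?_
    cases (l.1 == 1)
    · exact hU
    · exact Unitary.star_mem hU
  have hH : (hadamard ⊗ₖ hadamard) ⊗ₖ (1 : Matrix (Fin 2 × Q) (Fin 2 × Q) ℂ) ∈
      Matrix.unitaryGroup ((Fin 2 × Fin 2) × (Fin 2 × Q)) ℂ :=
    Matrix.kronecker_mem_unitary
      (Matrix.kronecker_mem_unitary hadamard_mem_unitary hadamard_mem_unitary) (one_mem _)
  exact mul_mem (mul_mem hH hsel) hH

section

variable {lam γ : ℝ} {A B : Ket (Qubits n × Qubits n)}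
  {UB : Matrix (Qubits n × Qubits k) (Qubits n × Qubits k) ℂ}
  {ρA : Matrix (Fin 2 × Qubits n) (Fin 2 × Qubits n) ℂ}
  {SA : Ket (Qubits m × (Fin 2 × Qubits n))}

theorem braket_lcuUnitary (hB : IsUBSE UB lam B) (hA : IsDMSE ρA 0 1 γ A)
    (hS : IsPurification SA ρA) (p : Part) :
    braket (initKet k SA) (((1 : Matrix (Fin 2) (Fin 2) ℂ) ⊗ₖ
      multiplexed (lcuEquiv (Fin 2 × Fin 2) (Qubits m) (Fin 2 × (Qubits n × Qubits k)))
        (fun _ => lcuUnitary UB p)) *ᵥ initKet k SA) =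
      ((γ * lam * p.of (braket B A) : ℝ) : ℂ) := by
  rw [← sum_lcuUnitary hB hA hS p, braket_initKet]
  refine Finset.sum_congr rfl fun x _ => ?_
  rw [mulVec_initKet]
  congr 1
  refine Finset.sum_congr rfl fun x' _ => ?_
  congr 1
  exact one_mul _

theorem abs_amplitude_le_one (hB : IsUBSE UB lam B) (hA : IsDMSE ρA 0 1 γ A)
    (hS : IsPurification SA ρA) (p : Part) : |γ * lam * p.of (braket B A)| ≤ 1 :=
  abs_le_one_of_braket_unitary (Matrix.kronecker_mem_unitary (one_mem _)
    (multiplexed_mem_unitary _ _ fun _ => lcuUnitary_mem_unitary hB.1 p))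
    (isPureState_initKet hA.1.2 hS) (braket_lcuUnitary hB hA hS p)

theorem braket_ctrlLCU (hB : IsUBSE UB lam B) (hA : IsDMSE ρA 0 1 γ A)
    (hS : IsPurification SA ρA) (p : Part) :
    braket (initKet k SA) (ctrlLCU m UB p *ᵥ initKet k SA) =
      (((1 + γ * lam * p.of (braket B A)) / 2 : ℝ) : ℂ) := by
  have h1 : braket (initKet k SA) (initKet k SA) = 1 := isPureState_initKet hA.1.2 hS
  have h2 : braket (initKet k SA) (ctrlLCU m UB p *ᵥ initKet k SA) =
      braket (initKet k SA) (((1 / 2 : ℂ) • (1 + (1 : Matrix (Fin 2) (Fin 2) ℂ) ⊗ₖ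
        multiplexed (lcuEquiv (Fin 2 × Fin 2) (Qubits m) (Fin 2 × (Qubits n × Qubits k)))
          (fun _ => lcuUnitary UB p))) *ᵥ initKet k SA) := by
    rw [braket_initKet, braket_initKet]
    refine Finset.sum_congr rfl fun x _ => ?_
    rw [mulVec_initKet, mulVec_initKet]
    congr 1
    refine Finset.sum_congr rfl fun x' _ => ?_
    congr 1
    simp only [regEquivS, Equiv.coe_fn_symm_mk, Prod.fst_zero, Prod.snd_zero]
    rw [ctrlLCU_apply_zero]
    simp [Matrix.one_apply]
  rw [h2, Matrix.smul_mulVec, Matrix.add_mulVec, Matrix.one_mulVec, braket_smul, braket_add, h1,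
    braket_lcuUnitary hB hA hS p]
  push_cast
  ring

/-- The outcome probability of the experiment with `r` Grover iterations. -/
theorem zeroProb_eq (hB : IsUBSE UB lam B) (hA : IsDMSE ρA 0 1 γ A)
    (hS : IsPurification SA ρA)
    {US : Matrix (Qubits m × (Fin 2 × Qubits n)) (Qubits m × (Fin 2 × Qubits n)) ℂ}
    (hUS : US ∈ Matrix.unitaryGroup (Qubits m × (Fin 2 × Qubits n)) ℂ)
    (hSA : US *ᵥ basisKet 0 = SA) (p : Part) {θ : ℝ}
    (hθ : Real.sin θ = (1 + γ * lam * p.of (braket B A)) / 2) (r : ℕ) :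
    zeroProb UB US p r = Real.sin ((2 * r + 1) * θ) ^ 2 := by
  have hs : IsPureState (initKet k SA) := isPureState_initKet hA.1.2 hS
  have hu : IsPureState (ctrlLCU m UB p *ᵥ initKet k SA) := by
    rw [IsPureState, braket_unitary (ctrlLCU_mem_unitary UB hB.1 p)]
    exact hs
  have hsu := braket_ctrlLCU hB hA hS p
  rw [← hθ] at hsu
  have hrot := (braket_grover_pow hs hu hsu r).1
  have hzero : ∀ v : Ket (Reg m n k), v 0 = braket (basisKet 0) v := by
    intro v
    rw [braket, dotProduct, Finset.sum_eq_single 0]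
    · simp [basisKet]
    · intro w _ hw
      simp [basisKet, hw]
    · simp
  rw [zeroProb, hzero (Circuit.eval UB US (experiment m n k p r) *ᵥ basisKet 0),
    eval_experiment UB US hB.1 hUS hSA, ← Matrix.mulVec_mulVec,
    queryS_mulVec_basisKet, hSA, mul_assoc, ← Matrix.mulVec_mulVec, ← Matrix.mulVec_mulVec,
    queryS_true_eq, braket_mulVec, Matrix.conjTranspose_conjTranspose, queryS_mulVec_basisKet, hSA,
    groverOp, ← ketbra_mulVec, hrot, Complex.norm_real, Real.norm_eq_abs, sq_abs]

end

end Amplitude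

/-! ### Finite adaptive procedures -/

/-- A procedure that surely terminates: a decision tree whose inner nodes run the experiment
with `r` Grover iterations and branch on the measurement result. -/
inductive Program (α : Type) : Type
  | ret (a : α)
  | run (r : ℕ) (next : Bool → Program α)

namespace Program

variable {α β : Type}

/-- Sequential composition. -/
def bind : Program α → (α → Program β) → Program β
  | ret a, f => f a
  | run r next, f => run r fun b => (next b).bind f

/-- Expectation of `F` at the output, when the experiment with `r` iterations has result `true` with
probability `q r`. -/
def ev (q : ℕ → ℝ) : Program α → (α → ℝ) → ℝ
  | ret a, F => F a
  | run r next, F => q r * (next true).ev q F + (1 - q r) * (next false).ev q F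

/-- The probability that the output lies in `S`. -/
noncomputable def prob (q : ℕ → ℝ) (P : Program α) (S : Set α) : ℝ := P.ev q (S.indicator 1)

/-- The number of queries in the worst case. -/
def cost : Program α → ℕ
  | ret _ => 0
  | run r next => (8 * r + 4) + max (next true).cost (next false).cost

open Classical in
/-- The probability that the program makes at most `T` queries and outputs an element of `G`. -/
noncomputable def succ (q : ℕ → ℝ) (G : Set ℝ) : Program ℝ → ℕ → ℝ
  | ret a, _ => if a ∈ G then 1 else 0
  | run r next, T => if 8 * r + 4 ≤ T then
      q r * (next true).succ q G (T - (8 * r + 4)) +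
        (1 - q r) * (next false).succ q G (T - (8 * r + 4)) else 0

/-- The next move of a program after the given results, oldest first. -/
def walk : Program ℝ → List Bool → Move
  | ret a, _ => .output a
  | run r _, [] => .run r
  | run _ next, b :: h => (next b).walk h

/-- A controller whose moves agree with those of a program on all histories that can occur within `T`
queries has the same success probability. -/
theorem successProb_eq_succ {m n k : ℕ}
    (UB : Matrix (Qubits n × Qubits k) (Qubits n × Qubits k) ℂ)
    (US : Matrix (Qubits m × (Fin 2 × Qubits n)) (Qubits m × (Fin 2 × Qubits n)) ℂ)
    (p : Part) (ctrl : Controller) (G : Set ℝ) (P : Program ℝ) (T : ℕ) (h : List Bool)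
    (hP : ∀ h' : List Bool, h'.length ≤ T → ctrl (h' ++ h) = P.walk h'.reverse) :
    successProb UB US p ctrl G T h = P.succ (zeroProb UB US p) G T := by
  induction P generalizing T h with
  | ret a =>
    have h0 : ctrl h = .output a := hP [] (Nat.zero_le _)
    rw [successProb, h0, succ]
  | run r next ih =>
    have h0 : ctrl h = .run r := hP [] (Nat.zero_le _)
    rw [successProb, h0, succ]
    simp only [queries_experiment]
    split_ifs with hr
    · have hb : ∀ b, successProb UB US p ctrl G (T - (8 * r + 4)) (b :: h) =
          (next b).succ (zeroProb UB US p) G (T - (8 * r + 4)) := by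
        intro b
        refine ih b _ _ fun h' hh' => ?_
        have := hP (h' ++ [b]) (by rw [List.length_append, List.length_singleton]; omega)
        rw [List.append_assoc, List.singleton_append] at this
        rw [this, List.reverse_append, List.reverse_singleton, List.singleton_append, walk]
      rw [hb, hb]
    · rfl

section Expectation

variable {q : ℕ → ℝ}

theorem ev_const (P : Program α) (c : ℝ) : P.ev q (fun _ => c) = c := by
  induction P with
  | ret a => rfl
  | run r next ih => rw [ev, ih, ih]; ring

theorem ev_sub_const (P : Program α) (F : α → ℝ) (c : ℝ) :
    P.ev q (fun a => F a - c) = P.ev q F - c := by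
  induction P with
  | ret a => rfl
  | run r next ih => rw [ev, ev, ih, ih]; ring

theorem ev_one_sub (P : Program α) (F : α → ℝ) :
    P.ev q (fun a => 1 - F a) = 1 - P.ev q F := by
  induction P with
  | ret a => rfl
  | run r next ih => rw [ev, ev, ih, ih]; ring

theorem ev_mul_const (P : Program α) (F : α → ℝ) (c : ℝ) :
    P.ev q (fun a => F a * c) = P.ev q F * c := by
  induction P with
  | ret a => rfl
  | run r next ih => rw [ev, ev, ih, ih]; ring

theorem ev_bind (P : Program α) (f : α → Program β) (F : β → ℝ) :
    (P.bind f).ev q F = P.ev q fun a => (f a).ev q F := by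
  induction P with
  | ret a => rfl
  | run r next ih => rw [bind, ev, ev, ih, ih]

theorem cost_bind_le (P : Program α) (f : α → Program β) {c : ℕ} (hc : ∀ a, (f a).cost ≤ c) :
    (P.bind f).cost ≤ P.cost + c := by
  induction P with
  | ret a => simpa [bind, cost] using hc a
  | run r next ih =>
    rw [bind, cost, cost]
    have h1 := ih true
    have h2 := ih false
    omega

variable (hq : ∀ r, 0 ≤ q r ∧ q r ≤ 1)
include hq

theorem ev_mono (P : Program α) {F F' : α → ℝ} (h : ∀ a, F a ≤ F' a) : P.ev q F ≤ P.ev q F' := by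
  induction P with
  | ret a => exact h a
  | run r next ih =>
    rw [ev, ev]
    have h1 := mul_le_mul_of_nonneg_left (ih true) (hq r).1
    have h2 := mul_le_mul_of_nonneg_left (ih false) (sub_nonneg.2 (hq r).2)
    linarith

theorem prob_nonneg (P : Program α) (S : Set α) : 0 ≤ P.prob q S := by
  rw [← P.ev_const (q := q) 0]
  exact P.ev_mono hq fun a => Set.indicator_nonneg (fun _ _ => zero_le_one) a

theorem prob_mono (P : Program α) {S S' : Set α} (h : S ⊆ S') : P.prob q S ≤ P.prob q S' :=
  P.ev_mono hq fun a => Set.indicator_le_indicator_of_subset h (fun _ => zero_le_one) a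

omit hq in
theorem prob_compl (P : Program α) (S : Set α) : P.prob q Sᶜ = 1 - P.prob q S := by
  rw [prob, prob, ← ev_one_sub, Set.indicator_compl]
  rfl

/-- Union bound for a composition: the first program misses `A` with probability at most `η₁`, and
from `A` the second one misses `S` with probability at most `η₂`. -/
theorem prob_bind_ge (P : Program α) (f : α → Program β) {A : Set α} {S : Set β} {η₁ η₂ : ℝ}
    (h₂ : 0 ≤ η₂) (hP : 1 - η₁ ≤ P.prob q A) (hf : ∀ a ∈ A, 1 - η₂ ≤ (f a).prob q S) :
    1 - (η₁ + η₂) ≤ (P.bind f).prob q S := by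
  have h : P.ev q (fun a => A.indicator 1 a - η₂) ≤ P.ev q fun a => (f a).prob q S := by
    refine P.ev_mono hq fun a => ?_
    by_cases ha : a ∈ A
    · simpa [ha] using hf a ha
    · have := (f a).prob_nonneg hq S
      simp only [ha, not_false_eq_true, Set.indicator_of_notMem]
      linarith
  rw [ev_sub_const] at h
  rw [prob, ev_bind]
  change _ ≤ P.ev q fun a => (f a).prob q S
  rw [prob] at hP
  linarith

theorem succ_nonneg (G : Set ℝ) (P : Program ℝ) (T : ℕ) : 0 ≤ P.succ q G T := by
  induction P generalizing T with
  | ret a => rw [succ]; split_ifs <;> norm_num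
  | run r next ih =>
    rw [succ]
    split_ifs
    · exact add_nonneg (mul_nonneg (hq r).1 (ih _ _))
        (mul_nonneg (sub_nonneg.2 (hq r).2) (ih _ _))
    · exact le_rfl

theorem succ_mono (G : Set ℝ) (P : Program ℝ) {T T' : ℕ} (hT : T ≤ T') :
    P.succ q G T ≤ P.succ q G T' := by
  induction P generalizing T T' with
  | ret a => simp only [succ, le_refl]
  | run r next ih =>
    by_cases h : 8 * r + 4 ≤ T
    · rw [succ, succ, if_pos h, if_pos (h.trans hT)]
      have hT' : T - (8 * r + 4) ≤ T' - (8 * r + 4) := Nat.sub_le_sub_right hT _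
      exact add_le_add (mul_le_mul_of_nonneg_left (ih _ hT') (hq r).1)
        (mul_le_mul_of_nonneg_left (ih _ hT') (sub_nonneg.2 (hq r).2))
    · rw [succ, if_neg h]
      exact succ_nonneg hq G _ _

theorem ev_le_succ_bind (G : Set ℝ) (P : Program α) (f : α → Program ℝ) (F : α → ℝ) {T T' : ℕ}
    (hT : P.cost + T' ≤ T) (hF : ∀ a, F a ≤ (f a).succ q G T') :
    P.ev q F ≤ (P.bind f).succ q G T := by
  induction P generalizing T with
  | ret a => exact (hF a).trans (succ_mono hq G _ (by simpa [cost] using hT))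
  | run r next ih =>
    rw [cost] at hT
    rw [bind, succ, ev, if_pos (by omega)]
    exact add_le_add (mul_le_mul_of_nonneg_left (ih true (by omega)) (hq r).1)
      (mul_le_mul_of_nonneg_left (ih false (by omega)) (sub_nonneg.2 (hq r).2))

theorem succ_bind_ge (G : Set ℝ) (P : Program α) (f : α → Program ℝ) {A : Set α} {η₁ η₂ : ℝ}
    {T T' : ℕ} (hT : P.cost + T' ≤ T) (h₂ : 0 ≤ η₂) (hP : 1 - η₁ ≤ P.prob q A)
    (hf : ∀ a ∈ A, 1 - η₂ ≤ (f a).succ q G T') :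
    1 - (η₁ + η₂) ≤ (P.bind f).succ q G T := by
  refine le_trans ?_ (ev_le_succ_bind hq G P f (fun a => A.indicator 1 a - η₂) hT fun a => ?_)
  · rw [ev_sub_const]
    rw [prob] at hP
    linarith
  · by_cases ha : a ∈ A
    · simpa [ha] using hf a ha
    · have := (f a).succ_nonneg hq G T'
      simp only [ha, not_false_eq_true, Set.indicator_of_notMem]
      linarith

end Expectation

/-! ### Repeated experiments -/

/-- Runs the experiment `N` times and outputs `c` plus the number of results `false`. -/
def countFalse (r : ℕ) : ℕ → ℕ → Program ℕ
  | 0, c => ret c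
  | N + 1, c => run r fun b => countFalse r N (if b then c else c + 1)

theorem cost_countFalse (r N c : ℕ) : (countFalse r N c).cost = N * (8 * r + 4) := by
  induction N generalizing c with
  | zero => simp [countFalse, cost]
  | succ N ih => simp only [countFalse, cost, ih, max_self]; ring

theorem ev_pow_countFalse (q : ℕ → ℝ) (z : ℝ) (r N c : ℕ) :
    (countFalse r N c).ev q (fun n => z ^ n) = z ^ c * (q r + (1 - q r) * z) ^ N := by
  induction N generalizing c with
  | zero => simp [countFalse, ev]
  | succ N ih =>
    simp only [countFalse, ev, ih, if_true, Bool.false_eq_true, if_false]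
    ring

/-- Bernstein's bound for the moment generating function of a `0`-`1` variable of mean `p`. -/
theorem one_sub_add_mul_exp_le {p t : ℝ} (h0 : 0 ≤ p) (h1 : p ≤ 1) (ht : |t| ≤ 1) :
    (1 - p) + p * Real.exp t ≤ Real.exp (p * t + t ^ 2) := by
  have h := (abs_le.1 (Real.abs_exp_sub_one_sub_id_le ht)).2
  have h2 : p * (Real.exp t - 1 - t) ≤ 1 * t ^ 2 :=
    (mul_le_mul_of_nonneg_left h h0).trans (mul_le_mul_of_nonneg_right h1 (sq_nonneg t))
  have h3 := Real.add_one_le_exp (p * t + t ^ 2)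
  linarith

section Tails

variable {q : ℕ → ℝ} (hq : ∀ r, 0 ≤ q r ∧ q r ≤ 1)
include hq

/-- Markov's inequality for the moment generating function. -/
theorem prob_countFalse_le {r N : ℕ} {S : Set ℕ} {z a : ℝ} (hz : 0 < z)
    (hS : ∀ n ∈ S, a ≤ z ^ n) (ha : 0 < a) :
    (countFalse r N 0).prob q S ≤ (q r + (1 - q r) * z) ^ N / a := by
  have h : (countFalse r N 0).prob q S ≤ (countFalse r N 0).ev q (fun n => z ^ n * a⁻¹) := by
    refine ev_mono hq _ fun n => ?_
    by_cases hn : n ∈ S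
    · have := hS n hn
      rw [Set.indicator_of_mem hn, Pi.one_apply, ← div_eq_mul_inv, le_div_iff₀ ha]
      linarith
    · rw [Set.indicator_of_notMem hn]
      positivity
  rwa [ev_mul_const, ev_pow_countFalse, pow_zero, one_mul, ← div_eq_mul_inv] at h

/-- A multiplicative tail bound: for a small probability `p` of `false`, a quarter of the results is
`false` only with probability `(16 p) ^ L`. -/
theorem prob_countFalse_mul_le {r L : ℕ} {p : ℝ} (hp : 0 < p) (hp1 : p ≤ 1) (hpq : 1 - q r ≤ p) :
    (countFalse r (4 * L) 0).prob q {n | L ≤ n} ≤ (16 * p) ^ L := by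
  refine (prob_countFalse_le hq (z := p⁻¹) (a := p⁻¹ ^ L) (inv_pos.2 hp)
    (fun n hn => pow_le_pow_right₀ ((one_le_inv₀ hp).2 hp1) hn) (by positivity)).trans ?_
  have h1 : (1 - q r) * p⁻¹ ≤ 1 := by
    rw [← div_eq_mul_inv, div_le_one hp]; exact hpq
  have h0 : 0 ≤ (1 - q r) * p⁻¹ := mul_nonneg (sub_nonneg.2 (hq r).2) (inv_pos.2 hp).le
  have h2 : (q r + (1 - q r) * p⁻¹) ^ (4 * L) ≤ 2 ^ (4 * L) :=
    pow_le_pow_left₀ (add_nonneg (hq r).1 h0) (by linarith [(hq r).2]) _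
  calc (q r + (1 - q r) * p⁻¹) ^ (4 * L) / p⁻¹ ^ L ≤ 2 ^ (4 * L) / p⁻¹ ^ L := by gcongr
    _ = (16 * p) ^ L := by
      rw [pow_mul, ← div_pow, div_inv_eq_mul]
      norm_num

/-- Both tails at once: `t > 0` bounds the upper tail and `t < 0` the lower one. -/
theorem prob_countFalse_tail {r N : ℕ} {t x : ℝ} (ht : |t| ≤ 1) :
    (countFalse r N 0).prob q {n | t * x ≤ t * n} ≤
      Real.exp (N * ((1 - q r) * t + t ^ 2) - t * x) := by
  refine (prob_countFalse_le hq (z := Real.exp t) (a := Real.exp (t * x)) (Real.exp_pos t)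
    (fun n hn => ?_) (Real.exp_pos _)).trans ?_
  · rw [← Real.exp_nat_mul, Real.exp_le_exp, mul_comm (n : ℝ)]
    exact hn
  · have h := one_sub_add_mul_exp_le (sub_nonneg.2 (hq r).2)
      (by linarith [(hq r).1] : 1 - q r ≤ 1) ht
    rw [sub_sub_cancel] at h
    rw [Real.exp_sub, Real.exp_nat_mul]
    gcongr
    have := mul_nonneg (sub_nonneg.2 (hq r).2) (Real.exp_pos t).le
    linarith [(hq r).1]

theorem prob_countFalse_ge_le {r N : ℕ} {g x : ℝ} (hg : 0 ≤ g) (hg2 : g ≤ 2)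
    (hx : (1 - q r + g) * N ≤ x) :
    (countFalse r N 0).prob q {n | x ≤ n} ≤ Real.exp (-(N * (g ^ 2 / 4))) := by
  have ht : |g / 2| ≤ 1 := by rw [abs_of_nonneg (by positivity)]; linarith
  refine ((prob_mono hq _ fun n hn => ?_).trans (prob_countFalse_tail hq (x := x) ht)).trans ?_
  · have hn' : x ≤ n := hn
    exact mul_le_mul_of_nonneg_left hn' (by positivity : 0 ≤ g / 2)
  · rw [Real.exp_le_exp]
    have := mul_le_mul_of_nonneg_left hx (by positivity : 0 ≤ g / 2)
    linarith

theorem prob_countFalse_lt_le {r N : ℕ} {g x : ℝ} (hg : 0 ≤ g) (hg2 : g ≤ 2)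
    (hx : x ≤ (1 - q r - g) * N) :
    (countFalse r N 0).prob q {n | (n : ℝ) < x} ≤ Real.exp (-(N * (g ^ 2 / 4))) := by
  have ht : |-(g / 2)| ≤ 1 := by rw [abs_neg, abs_of_nonneg (by positivity)]; linarith
  refine ((prob_mono hq _ fun n hn => ?_).trans (prob_countFalse_tail hq (x := x) ht)).trans ?_
  · have hn' : (n : ℝ) < x := hn
    exact mul_le_mul_of_nonpos_left hn'.le (by linarith : -(g / 2) ≤ 0)
  · rw [Real.exp_le_exp]
    have := mul_le_mul_of_nonneg_left hx (by positivity : 0 ≤ g / 2)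
    linarith

end Tails

end Program

/-! ### Iteration numbers that separate angles -/

theorem exists_half_le_sin_mul {e : ℝ} (h0 : 0 < e) (h1 : e ≤ Real.pi / 2) {D : ℕ} (hD : 1 ≤ D)
    (hDe : Real.pi / (2 * e) ≤ D) : ∃ d : ℕ, d ≤ D ∧ 1 / 2 ≤ Real.sin (d * e) := by
  have hpi := Real.pi_pos
  by_cases he : Real.pi / 6 ≤ e
  · refine ⟨1, hD, ?_⟩
    rw [← Real.sin_pi_div_six, Nat.cast_one, one_mul]
    exact Real.sin_le_sin_of_le_of_le_pi_div_two (by linarith) h1 he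
  · push Not at he
    refine ⟨⌊Real.pi / (2 * e)⌋₊, Nat.floor_le_of_le hDe, ?_⟩
    have hf1 := Nat.floor_le (by positivity : 0 ≤ Real.pi / (2 * e))
    have hf2 := Nat.lt_floor_add_one (Real.pi / (2 * e))
    have hme : Real.pi / (2 * e) * e = Real.pi / 2 := by field_simp
    have g1 := mul_le_mul_of_nonneg_right hf1 h0.le
    have g2 := mul_lt_mul_of_pos_right hf2 h0
    rw [hme] at g1 g2
    rw [← Real.sin_pi_div_six]
    exact Real.sin_le_sin_of_le_of_le_pi_div_two (by linarith) g1 (by linarith)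

/-- Some multiple of `2c` with a small multiplier is far from all multiples of `π`, unless `c` is
close to `π / 2`. -/
theorem exists_half_le_abs_sin_mul {c w : ℝ} (hw : 0 < w) (hc0 : w ≤ c) (hc1 : c ≤ Real.pi - w)
    (hcw : 2 * w ≤ |2 * c - Real.pi|) {D : ℕ} (hD : 1 ≤ D) (hDw : Real.pi / (4 * w) ≤ D) :
    ∃ d : ℕ, d ≤ D ∧ 1 / 2 ≤ |Real.sin (d * (2 * c))| := by
  have hpi := Real.pi_pos
  have hDe : ∀ e, 2 * w ≤ e → Real.pi / (2 * e) ≤ D := by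
    intro e he
    refine le_trans ?_ hDw
    apply div_le_div_of_nonneg_left hpi.le (by positivity) (by linarith)
  have main : ∀ e, 2 * w ≤ e → e ≤ Real.pi / 2 →
      (∀ d : ℕ, |Real.sin (d * (2 * c))| = |Real.sin (d * e)|) →
      ∃ d : ℕ, d ≤ D ∧ 1 / 2 ≤ |Real.sin (d * (2 * c))| := by
    intro e he1 he2 he3
    obtain ⟨d, hd, hs⟩ := exists_half_le_sin_mul (by linarith) he2 hD (hDe e he1)
    exact ⟨d, hd, by rw [he3]; exact hs.trans (le_abs_self _)⟩
  by_cases h1 : c ≤ Real.pi / 4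
  · exact main (2 * c) (by linarith) (by linarith) fun d => rfl
  by_cases h2 : 3 * Real.pi / 4 ≤ c
  · refine main (2 * Real.pi - 2 * c) (by linarith) (by linarith) fun d => ?_
    have : (d : ℝ) * (2 * c) = d * (2 * Real.pi) - d * (2 * Real.pi - 2 * c) := by ring
    rw [this, Real.sin_nat_mul_two_pi_sub, abs_neg]
  push Not at h1 h2
  refine main |2 * c - Real.pi| hcw (by rw [abs_le]; constructor <;> linarith) fun d => ?_
  have e1 : (d : ℝ) * (2 * c) = d * (2 * c - Real.pi) + d * Real.pi := by ring
  have e2 : |Real.sin (d * |2 * c - Real.pi|)| = |Real.sin (d * (2 * c - Real.pi))| := by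
    rcases abs_choice (2 * c - Real.pi) with h | h
    · rw [h]
    · rw [h, mul_neg, Real.sin_neg, abs_neg]
  rw [e2, e1, Real.sin_add_nat_mul_pi, abs_mul, abs_pow, abs_neg, abs_one, one_pow, one_mul]

/-- For an interval of width `w`, there is an odd multiplier of order `1 / w` that sends the
centre of the doubled interval far from all multiples of `π`. -/
theorem exists_odd_multiplier {c w : ℝ} (hw : 0 < w) (hw1 : w ≤ 1 / 10) (hc0 : w ≤ c)
    (hc1 : c ≤ Real.pi - w) :
    ∃ r : ℕ, 3 / 5 ≤ (2 * r + 1) * w ∧ (2 * r + 1) * w ≤ 27 / 10 ∧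
      1 / 5 ≤ |Real.sin ((2 * r + 1) * c)| := by
  have hpi := Real.pi_gt_d2
  have hpi' := Real.pi_lt_d2
  set D : ℕ := ⌈Real.pi / (4 * w)⌉₊ with hD
  have hDw : Real.pi / (4 * w) ≤ D := Nat.le_ceil _
  have hDw' : (D : ℝ) < Real.pi / (4 * w) + 1 := Nat.ceil_lt_add_one (by positivity)
  have hme : Real.pi / (4 * w) * w = Real.pi / 4 := by field_simp
  have g1 := mul_le_mul_of_nonneg_right hDw hw.le
  have g2 := mul_lt_mul_of_pos_right hDw' hw
  rw [add_mul, hme] at g2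
  rw [hme] at g1
  have hD1 : 1 ≤ D := Nat.ceil_pos.2 (by positivity)
  -- the odd number `2 * r₀ + 1` is `D` or `D - 1`
  obtain ⟨r₀, hr1, hr2⟩ : ∃ r₀ : ℕ, 2 * r₀ + 1 ≤ D ∧ D ≤ 2 * r₀ + 2 :=
    ⟨(D - 1) / 2, by omega, by omega⟩
  have hr1' : (2 * (r₀ : ℝ) + 1) ≤ D := by exact_mod_cast hr1
  have hr2' : (D : ℝ) ≤ 2 * (r₀ : ℝ) + 2 := by exact_mod_cast hr2
  have k1 := mul_le_mul_of_nonneg_right hr1' hw.le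
  have k2 := mul_le_mul_of_nonneg_right hr2' hw.le
  by_cases hs : 1 / 5 ≤ |Real.sin ((2 * r₀ + 1) * c)|
  · exact ⟨r₀, by linarith, by linarith, hs⟩
  push Not at hs
  by_cases hcw : 2 * w ≤ |2 * c - Real.pi|
  · obtain ⟨d, hd, hsd⟩ := exists_half_le_abs_sin_mul hw hc0 hc1 hcw hD1 hDw
    have hd' : (d : ℝ) ≤ D := by exact_mod_cast hd
    have k3 := mul_le_mul_of_nonneg_right hd' hw.le
    have hd0 : 0 ≤ (d : ℝ) * w := by positivity
    refine ⟨r₀ + d, by push_cast; linarith, by push_cast; linarith, ?_⟩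
    have e : (2 * ((r₀ + d : ℕ) : ℝ) + 1) * c = (2 * r₀ + 1) * c + d * (2 * c) := by
      push_cast; ring
    rw [e, Real.sin_add]
    have hC : 9 / 10 ≤ |Real.cos ((2 * r₀ + 1) * c)| := by
      rw [← sq_le_sq₀ (by norm_num) (abs_nonneg _), sq_abs, Real.cos_sq']
      have := pow_le_pow_left₀ (abs_nonneg _) hs.le 2
      rw [sq_abs] at this
      linarith
    have t1 : 9 / 10 * (1 / 2) ≤ |Real.cos ((2 * r₀ + 1) * c) * Real.sin (d * (2 * c))| := by
      rw [abs_mul]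
      exact mul_le_mul hC hsd (by norm_num) (abs_nonneg _)
    have t2 : |Real.sin ((2 * r₀ + 1) * c) * Real.cos (d * (2 * c))| ≤ 1 / 5 * 1 := by
      rw [abs_mul]
      exact mul_le_mul hs.le (Real.abs_cos_le_one _) (abs_nonneg _) (by norm_num)
    have t3 := abs_sub_abs_le_abs_add (Real.cos ((2 * r₀ + 1) * c) * Real.sin (d * (2 * c)))
      (Real.sin ((2 * r₀ + 1) * c) * Real.cos (d * (2 * c)))
    rw [add_comm (Real.cos _ * _)] at t3
    linarith
  · exfalso
    push Not at hcw
    set y := (2 * r₀ + 1) * (c - Real.pi / 2) with hy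
    have e : (2 * (r₀ : ℝ) + 1) * c = y + Real.pi / 2 + r₀ * Real.pi := by rw [hy]; ring
    rw [e, Real.sin_add_nat_mul_pi, abs_mul, abs_pow, abs_neg, abs_one, one_pow, one_mul,
      Real.sin_add_pi_div_two] at hs
    have hy1 : |y| ≤ 1 := by
      have : |c - Real.pi / 2| ≤ w := by
        rw [abs_lt] at hcw
        rw [abs_le]
        constructor <;> linarith [hcw.1, hcw.2]
      rw [hy, abs_mul, abs_of_nonneg (by positivity : 0 ≤ 2 * (r₀ : ℝ) + 1)]
      have := mul_le_mul_of_nonneg_left this (by positivity : 0 ≤ 2 * (r₀ : ℝ) + 1)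
      linarith
    have hcos : Real.cos 1 ≤ Real.cos y := by
      rw [← Real.cos_abs y]
      exact Real.cos_le_cos_of_nonneg_of_le_pi (abs_nonneg _) (by linarith) hy1
    have := Real.cos_one_pos
    have h12 : (1 : ℝ) / 2 ≤ Real.cos 1 := by
      have := Real.one_sub_sq_div_two_le_cos (x := 1)
      linarith
    linarith [le_abs_self (Real.cos y)]

theorem div_two_le_sin {x : ℝ} (h0 : 0 ≤ x) (h1 : x ≤ Real.pi / 2) : x / 2 ≤ Real.sin x := by
  have hpi := Real.pi_lt_d2
  refine le_trans ?_ (Real.mul_le_sin h0 h1)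
  rw [div_mul_eq_mul_div, le_div_iff₀ Real.pi_pos]
  nlinarith

/-- A lower bound for the sine on `[a, π - a]`. -/
theorem div_two_le_sin_of_mem {a x : ℝ} (h0 : 0 ≤ a) (h1 : a ≤ x) (h2 : x ≤ Real.pi - a) :
    a / 2 ≤ Real.sin x := by
  by_cases h : x ≤ Real.pi / 2
  · exact le_trans (by linarith) (div_two_le_sin (h0.trans h1) h)
  · push Not at h
    rw [← Real.sin_pi_sub]
    exact le_trans (by linarith) (div_two_le_sin (x := Real.pi - x) (by linarith) (by linarith))

theorem cos_sq_sub_cos_sq (x y : ℝ) :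
    Real.cos x ^ 2 - Real.cos y ^ 2 = Real.sin (x + y) * Real.sin (y - x) := by
  rw [Real.sin_add, Real.sin_sub]
  linear_combination (Real.cos x ^ 2) * (Real.sin_sq_add_cos_sq y).symm -
    (Real.cos y ^ 2) * (Real.sin_sq_add_cos_sq x).symm

/-- Some experiment of cost of order `1 / w` distinguishes the two ends of an interval of
angles of width `w`. -/
theorem exists_separating_iteration {lo w : ℝ} (h0 : 0 ≤ lo) (hw : 0 < w)
    (h1 : lo + w ≤ Real.pi / 2) :
    ∃ r : ℕ, (2 * r + 1) * w ≤ 3 ∧ ∃ s : ℝ, (s = 1 ∨ s = -1) ∧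
      ∀ θ₁ ∈ Set.Icc lo (lo + w / 32), ∀ θ₂ ∈ Set.Icc (lo + w * (31 / 32)) (lo + w),
        1 / 500 ≤ s * (Real.cos ((2 * r + 1) * θ₁) ^ 2 - Real.cos ((2 * r + 1) * θ₂) ^ 2) := by
  have hpi := Real.pi_gt_d2
  have hpi' := Real.pi_lt_d2
  -- it suffices that the mean of the two angles is mapped to where the sine is not small
  suffices h : ∃ r : ℕ, 1 / 10 ≤ (2 * r + 1) * w ∧ (2 * r + 1) * w ≤ 27 / 10 ∧
      ∃ s : ℝ, (s = 1 ∨ s = -1) ∧ ∀ y : ℝ, |y - (2 * lo + w)| ≤ w / 32 →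
        1 / 21 ≤ s * Real.sin ((2 * r + 1) * y) by
    obtain ⟨r, hr1, hr2, s, hs, hy⟩ := h
    refine ⟨r, by linarith, s, hs, fun θ₁ hθ₁ θ₂ hθ₂ => ?_⟩
    rw [cos_sq_sub_cos_sq, ← mul_assoc, ← mul_add, ← mul_sub]
    have t1 := hy (θ₁ + θ₂) (by
      rw [abs_le]; constructor <;> linarith [hθ₁.1, hθ₁.2, hθ₂.1, hθ₂.2])
    have hd1 : w * (15 / 16) ≤ θ₂ - θ₁ := by linarith [hθ₁.2, hθ₂.1]
    have hd2 : θ₂ - θ₁ ≤ w := by linarith [hθ₁.1, hθ₂.2]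
    have hM : 0 ≤ 2 * (r : ℝ) + 1 := by positivity
    have m1 := mul_le_mul_of_nonneg_left hd1 hM
    have m2 := mul_le_mul_of_nonneg_left hd2 hM
    have t2 : 3 / 32 / 2 ≤ Real.sin ((2 * r + 1) * (θ₂ - θ₁)) :=
      div_two_le_sin_of_mem (by norm_num) (by linarith) (by linarith)
    calc (1 : ℝ) / 500 ≤ 1 / 21 * (3 / 32 / 2) := by norm_num
      _ ≤ _ := mul_le_mul t1 t2 (by norm_num) (by linarith)
  by_cases hw1 : w ≤ 1 / 10
  · obtain ⟨r, hr1, hr2, hs⟩ := exists_odd_multiplier (c := 2 * lo + w) hw hw1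
      (by linarith) (by linarith)
    have hlip : ∀ y : ℝ, |y - (2 * lo + w)| ≤ w / 32 →
        |Real.sin ((2 * r + 1) * y) - Real.sin ((2 * r + 1) * (2 * lo + w))| ≤ 27 / 320 := by
      intro y hy
      have hM : 0 ≤ 2 * (r : ℝ) + 1 := by positivity
      refine (Real.abs_sin_sub_sin_le _ _).trans ?_
      rw [← mul_sub, abs_mul, abs_of_nonneg hM]
      have := mul_le_mul_of_nonneg_left hy hM
      linarith
    refine ⟨r, by linarith, hr2, ?_⟩
    rcases le_abs.1 hs with h | h
    · refine ⟨1, Or.inl rfl, fun y hy => ?_⟩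
      have := (abs_le.1 (hlip y hy)).1
      linarith
    · refine ⟨-1, Or.inr rfl, fun y hy => ?_⟩
      have := (abs_le.1 (hlip y hy)).2
      linarith
  · push Not at hw1
    refine ⟨0, ?_, ?_, 1, Or.inl rfl, fun y hy => ?_⟩
    · push_cast; linarith
    · push_cast; linarith
    · rw [abs_le] at hy
      have := div_two_le_sin_of_mem (a := w * (31 / 32)) (x := y) (by positivity)
        (by linarith [hy.1]) (by linarith [hy.2])
      simp only [Nat.cast_zero, mul_zero, zero_add, one_mul]
      linarith

/-! ### Estimating the angle to a given additive precision -/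

/-- The outcome probabilities of the experiments when the amplitude is `sin θ`. -/
noncomputable def angleProb (θ : ℝ) (r : ℕ) : ℝ := Real.sin ((2 * r + 1) * θ) ^ 2

theorem angleProb_mem (θ : ℝ) (r : ℕ) : 0 ≤ angleProb θ r ∧ angleProb θ r ≤ 1 :=
  ⟨sq_nonneg _, Real.sin_sq_le_one _⟩

theorem one_sub_angleProb (θ : ℝ) (r : ℕ) : 1 - angleProb θ r = Real.cos ((2 * r + 1) * θ) ^ 2 :=
  (Real.cos_sq' _).symm

/-- A threshold for the probability of `false` that separates the two ends of an interval. -/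
theorem exists_threshold {f : ℝ → ℝ} {I J : Set ℝ} (hJ : J.Nonempty) {g : ℝ}
    (h : ∀ x ∈ I, ∀ y ∈ J, g ≤ f x - f y) (hI : I.Nonempty) :
    ∃ c, (∀ x ∈ I, c + g / 2 ≤ f x) ∧ ∀ y ∈ J, f y ≤ c - g / 2 := by
  obtain ⟨x₀, hx₀⟩ := hI
  have hbd : BddAbove (f '' J) := by
    refine ⟨f x₀ - g, ?_⟩
    rintro _ ⟨y, hy, rfl⟩
    linarith [h x₀ hx₀ y hy]
  refine ⟨sSup (f '' J) + g / 2, fun x hx => ?_, fun y hy => ?_⟩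
  · have : sSup (f '' J) ≤ f x - g := by
      refine csSup_le (hJ.image f) ?_
      rintro _ ⟨y, hy, rfl⟩
      linarith [h x hx y hy]
    linarith
  · have := le_csSup hbd (Set.mem_image_of_mem f hy)
    linarith

/-- One round of interval refinement: discards one of the two ends of an interval of angles; the
output `true` keeps the lower part. -/
theorem exists_round {lo w : ℝ} (h0 : 0 ≤ lo) (hw : 0 < w) (h1 : lo + w ≤ Real.pi / 2) (K : ℕ) :
    ∃ P : Program Bool, (P.cost : ℝ) ≤ 12 * (4000000 * K) / w ∧
      ∀ θ ∈ Set.Icc lo (lo + w), 1 - (1 / 2 : ℝ) ^ K ≤ P.prob (angleProb θ)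
        {b | (b = true → θ ≤ lo + w * (31 / 32)) ∧ (b = false → lo + w / 32 ≤ θ)} := by
  obtain ⟨r, hr, s, hs, hsep⟩ := exists_separating_iteration h0 hw h1
  -- for the deviation `g = 1 / 1000`, half the gap, the tail bound `exp (-N g² / 4)` is `exp (-K)`
  set N : ℕ := 4000000 * K with hN
  have hcost : ∀ f : ℕ → Bool,
      ((((Program.countFalse r N 0).bind fun n => .ret (f n)).cost : ℕ) : ℝ) ≤
        12 * (4000000 * K) / w := by
    intro f
    have h := Program.cost_bind_le (Program.countFalse r N 0) (fun n => .ret (f n)) (c := 0)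
      fun _ => le_rfl
    rw [add_zero, Program.cost_countFalse] at h
    have h' : ((((Program.countFalse r N 0).bind fun n => .ret (f n)).cost : ℕ) : ℝ) ≤
        4 * (4000000 * K) * (2 * r + 1) := by
      refine (Nat.cast_le.2 h).trans (le_of_eq ?_)
      rw [hN]; push_cast; ring
    refine h'.trans ?_
    rw [le_div_iff₀ hw]
    have := mul_le_mul_of_nonneg_left hr (by positivity : 0 ≤ 4 * (4000000 * (K : ℝ)))
    linarith
  have hexp : Real.exp (-(N * ((1 / 500 : ℝ) ^ 2 / 2 ^ 2 / 4))) ≤ (1 / 2 : ℝ) ^ K := by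
    have h2 : Real.exp (-1) ≤ 1 / 2 := by
      rw [Real.exp_neg, one_div]
      exact inv_anti₀ (by norm_num) (by linarith [Real.add_one_le_exp 1])
    have e : -((N : ℝ) * ((1 / 500 : ℝ) ^ 2 / 2 ^ 2 / 4)) = K * (-1) := by
      rw [hN]; push_cast; ring
    rw [e, Real.exp_nat_mul]
    exact pow_le_pow_left₀ (Real.exp_pos _).le h2 _
  have hbad : ∀ θ (f : ℕ → Bool) (S : Set Bool),
      (Program.countFalse r N 0).prob (angleProb θ) {n | f n ∈ S}ᶜ ≤ (1 / 2 : ℝ) ^ K →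
      1 - (1 / 2 : ℝ) ^ K ≤
        ((Program.countFalse r N 0).bind fun n => .ret (f n)).prob (angleProb θ) S := by
    intro θ f S h
    rw [Program.prob_compl] at h
    rw [Program.prob, Program.ev_bind]
    have : (fun n => (Program.ret (f n)).ev (angleProb θ) (S.indicator 1)) =
        {n | f n ∈ S}.indicator (1 : ℕ → ℝ) := rfl
    rw [this]
    change _ ≤ (Program.countFalse r N 0).prob (angleProb θ) _
    linarith
  have hlow : ∀ θ x, (x + 1 / 1000) ≤ 1 - angleProb θ r →
      (Program.countFalse r N 0).prob (angleProb θ) {n | (n : ℝ) < x * N} ≤ (1 / 2 : ℝ) ^ K := by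
    intro θ x hx
    refine (Program.prob_countFalse_lt_le (angleProb_mem θ) (g := 1 / 1000) (by norm_num)
      (by norm_num) ?_).trans (le_trans (le_of_eq ?_) hexp)
    · exact mul_le_mul_of_nonneg_right (by linarith) (Nat.cast_nonneg _)
    · norm_num
  have hhigh : ∀ θ x, 1 - angleProb θ r ≤ x - 1 / 1000 →
      (Program.countFalse r N 0).prob (angleProb θ) {n | x * N ≤ (n : ℝ)} ≤ (1 / 2 : ℝ) ^ K := by
    intro θ x hx
    refine (Program.prob_countFalse_ge_le (angleProb_mem θ) (g := 1 / 1000) (by norm_num)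
      (by norm_num) ?_).trans (le_trans (le_of_eq ?_) hexp)
    · exact mul_le_mul_of_nonneg_right (by linarith) (Nat.cast_nonneg _)
    · norm_num
  have hpos : (0 : ℝ) ≤ (1 / 2) ^ K := by positivity
  set I := Set.Icc lo (lo + w / 32) with hI
  set J := Set.Icc (lo + w * (31 / 32)) (lo + w) with hJ
  have hIne : I.Nonempty := Set.nonempty_Icc.2 (by linarith)
  have hJne : J.Nonempty := Set.nonempty_Icc.2 (by linarith)
  have hempty : ∀ θ, (Program.countFalse r N 0).prob (angleProb θ) ∅ ≤ (1 / 2 : ℝ) ^ K := by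
    intro θ
    rw [Program.prob, Set.indicator_empty]
    exact (Program.ev_const _ 0).trans_le hpos
  -- in the middle of the interval every output is correct
  have hmid : ∀ θ, lo + w / 32 < θ → θ < lo + w * (31 / 32) → ∀ f : ℕ → Bool,
      {n | f n ∈ {b : Bool | (b = true → θ ≤ lo + w * (31 / 32)) ∧
        (b = false → lo + w / 32 ≤ θ)}}ᶜ = (∅ : Set ℕ) := by
    intro θ hθ1 hθ2 f
    rw [Set.compl_empty_iff, Set.eq_univ_iff_forall]
    exact fun n => ⟨fun _ => hθ2.le, fun _ => hθ1.le⟩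
  rcases hs with rfl | rfl
  · obtain ⟨c, hc1, hc2⟩ := exists_threshold (I := I) (J := J)
      (f := fun θ => Real.cos ((2 * r + 1) * θ) ^ 2) hJne (g := 1 / 500)
      (fun x hx y hy => by simpa using hsep x hx y hy) hIne
    refine ⟨_, hcost fun n => decide (c * N ≤ n), fun θ hθ => hbad _ _ _ ?_⟩
    by_cases hθI : θ ≤ lo + w / 32
    · refine (Program.prob_mono (angleProb_mem θ) _ ?_).trans (hlow θ c ?_)
      · intro n hn
        by_contra hcon
        refine hn ⟨fun _ => by linarith, fun h => ?_⟩
        exact absurd (not_lt.1 hcon) (of_decide_eq_false h)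
      · rw [one_sub_angleProb]
        linarith [hc1 θ ⟨hθ.1, hθI⟩]
    by_cases hθJ : lo + w * (31 / 32) ≤ θ
    · refine (Program.prob_mono (angleProb_mem θ) _ ?_).trans (hhigh θ c ?_)
      · intro n hn
        by_contra hcon
        refine hn ⟨fun h => ?_, fun _ => by linarith⟩
        exact absurd (of_decide_eq_true h) hcon
      · rw [one_sub_angleProb]
        linarith [hc2 θ ⟨hθJ, hθ.2⟩]
    push Not at hθI hθJ
    rw [hmid θ hθI hθJ]
    exact hempty θ
  · obtain ⟨c, hc1, hc2⟩ := exists_threshold (I := J) (J := I)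
      (f := fun θ => Real.cos ((2 * r + 1) * θ) ^ 2) hIne (g := 1 / 500)
      (fun x hx y hy => by have := hsep y hy x hx; linarith) hJne
    refine ⟨_, hcost fun n => decide ((n : ℝ) < c * N), fun θ hθ => hbad _ _ _ ?_⟩
    by_cases hθI : θ ≤ lo + w / 32
    · refine (Program.prob_mono (angleProb_mem θ) _ ?_).trans (hhigh θ c ?_)
      · intro n hn
        by_contra hcon
        refine hn ⟨fun _ => by linarith, fun h => ?_⟩
        exact absurd (not_le.1 hcon) (of_decide_eq_false h)
      · rw [one_sub_angleProb]
        linarith [hc2 θ ⟨hθ.1, hθI⟩]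
    by_cases hθJ : lo + w * (31 / 32) ≤ θ
    · refine (Program.prob_mono (angleProb_mem θ) _ ?_).trans (hlow θ c ?_)
      · intro n hn
        by_contra hcon
        refine hn ⟨fun h => ?_, fun _ => by linarith⟩
        exact absurd (of_decide_eq_true h) hcon
      · rw [one_sub_angleProb]
        linarith [hc1 θ ⟨hθJ, hθ.2⟩]
    push Not at hθI hθJ
    rw [hmid θ hθI hθJ]
    exact hempty θ

/-- Interval refinement with `i` rounds. Early rounds are cheap, so they can afford more
repetitions: the round with `j` rounds to go fails with probability at most `2 ^ (-(L + j))`. The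
bracket in the cost bound is the solution of `F (i + 1) = L + i + 1 + (32 / 31) F i`, `F 0 = 0`. -/
theorem exists_refinement (L i : ℕ) {lo w : ℝ} (h0 : 0 ≤ lo) (hw : 0 < w)
    (h1 : lo + w ≤ Real.pi / 2) :
    ∃ P : Program ℝ, (P.cost : ℝ) ≤ 48000000 *
        ((31 * L + 992) * (32 / 31) ^ i - (31 * L + 31 * i + 992)) / w ∧
      ∀ θ ∈ Set.Icc lo (lo + w), 1 - (1 / 2 : ℝ) ^ L * (1 - (1 / 2) ^ i) ≤
        P.prob (angleProb θ) {a | |a - θ| ≤ w * (31 / 32) ^ i} := by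
  induction i generalizing lo w with
  | zero =>
    refine ⟨.ret lo, ?_, fun θ hθ => ?_⟩
    · simp [Program.cost]
    · have : lo ∈ {a : ℝ | |a - θ| ≤ w * (31 / 32) ^ 0} := by
        change |lo - θ| ≤ _
        rw [abs_le]
        constructor <;> linarith [hθ.1, hθ.2]
      rw [Program.prob, Program.ev, Set.indicator_of_mem this]
      simp
  | succ i ih =>
    obtain ⟨P, hPc, hP⟩ := exists_round h0 hw h1 (L + i + 1)
    have hw' : 0 < w * (31 / 32) := by positivity
    obtain ⟨Q₁, hQ₁c, hQ₁⟩ := ih (lo := lo) (w := w * (31 / 32)) h0 hw' (by linarith)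
    obtain ⟨Q₂, hQ₂c, hQ₂⟩ := ih (lo := lo + w / 32) (w := w * (31 / 32)) (by positivity) hw'
      (by linarith)
    refine ⟨P.bind fun b => if b then Q₁ else Q₂, ?_, fun θ hθ => ?_⟩
    · have hmax : ((max Q₁.cost Q₂.cost : ℕ) : ℝ) ≤ 48000000 *
          ((31 * L + 992) * (32 / 31) ^ i - (31 * L + 31 * i + 992)) / (w * (31 / 32)) := by
        rw [Nat.cast_max]
        exact max_le hQ₁c hQ₂c
      have hb : ((P.bind fun b => if b then Q₁ else Q₂).cost : ℝ) ≤
          P.cost + (max Q₁.cost Q₂.cost : ℕ) := by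
        rw [← Nat.cast_add]
        refine Nat.cast_le.2 (Program.cost_bind_le P _ fun b => ?_)
        cases b
        · exact le_max_right _ _
        · exact le_max_left _ _
      refine (hb.trans (add_le_add hPc hmax)).trans ?_
      have e : ∀ x : ℝ, x / (w * (31 / 32)) = x * (32 / 31) / w := by
        intro x
        rw [← div_div, div_right_comm]
        norm_num [div_eq_mul_inv]
      rw [e, ← add_div]
      refine div_le_div_of_nonneg_right (le_of_eq ?_) hw.le
      push_cast
      ring
    · have hstep := Program.prob_bind_ge (angleProb_mem θ) P (fun b => if b then Q₁ else Q₂)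
        (η₂ := (1 / 2 : ℝ) ^ L * (1 - (1 / 2) ^ i))
        (S := {a | |a - θ| ≤ w * (31 / 32) ^ (i + 1)})
        (mul_nonneg (by positivity) (sub_nonneg.2 (pow_le_one₀ (by norm_num) (by norm_num))))
        (hP θ hθ) fun b hb => ?_
      · refine le_trans (le_of_eq ?_) hstep
        rw [add_assoc L, pow_add]
        ring
      · have e : w * (31 / 32 : ℝ) ^ (i + 1) = w * (31 / 32) * (31 / 32) ^ i := by ring
        rw [e]
        cases b
        · exact hQ₂ θ ⟨hb.2 rfl, by linarith [hθ.2]⟩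
        · exact hQ₁ θ ⟨hθ.1, hb.1 rfl⟩

/-- Angle estimation: precision `τ` and failure probability `2 ^ (-L)` cost `O(L / τ)` queries. -/
theorem exists_angle_estimation (L : ℕ) {τ : ℝ} (hτ : 0 < τ) (hτ1 : τ ≤ 1) :
    ∃ P : Program ℝ, (P.cost : ℝ) ≤ 10 ^ 11 * (L + 1) / τ ∧
      ∀ θ ∈ Set.Icc 0 (Real.pi / 2), 1 - (1 / 2 : ℝ) ^ L ≤
        P.prob (angleProb θ) {a | |a - θ| ≤ τ} := by
  have hpi := Real.pi_gt_d2
  have hx : 1 ≤ Real.pi / 2 / τ := by rw [le_div_iff₀ hτ]; linarith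
  obtain ⟨i, hi1, hi2⟩ := exists_nat_pow_near hx (by norm_num : (1 : ℝ) < 32 / 31)
  obtain ⟨P, hPc, hP⟩ := exists_refinement L (i + 1) le_rfl (by positivity : 0 < Real.pi / 2)
    (by rw [zero_add])
  rw [zero_add] at hP
  refine ⟨P, hPc.trans ?_, fun θ hθ => ?_⟩
  · rw [div_le_iff₀ (by positivity)]
    have e : 10 ^ 11 * ((L : ℝ) + 1) / τ * (Real.pi / 2) =
      10 ^ 11 * ((L : ℝ) + 1) * (Real.pi / 2 / τ) := by ring
    rw [e]
    have hA : (0 : ℝ) ≤ 31 * L + 992 := by positivity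
    have h1 : (31 * (L : ℝ) + 992) * (32 / 31) ^ (i + 1) ≤
        992 * (L + 1) * (2 * (Real.pi / 2 / τ)) := by
      refine mul_le_mul (by linarith [(Nat.cast_nonneg L : (0 : ℝ) ≤ L)]) ?_ (by positivity)
        (by positivity)
      rw [pow_succ]
      have : (0 : ℝ) < (32 / 31) ^ i := by positivity
      linarith
    have h2 : (0 : ℝ) ≤ 31 * L + 31 * (i + 1 : ℕ) + 992 := by positivity
    have h3 : 0 ≤ ((L : ℝ) + 1) * (Real.pi / 2 / τ) := by positivity
    linarith
  · refine le_trans ?_ ((hP θ hθ).trans (Program.prob_mono (angleProb_mem θ) P fun a ha => ?_))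
    · have h1 : (0 : ℝ) ≤ (1 / 2) ^ L := by positivity
      have h2 : (0 : ℝ) ≤ (1 / 2) ^ (i + 1) := by positivity
      nlinarith
    · have ha' : |a - θ| ≤ Real.pi / 2 * (31 / 32) ^ (i + 1) := ha
      refine ha'.trans ?_
      rw [div_lt_iff₀ hτ] at hi2
      have e : (31 / 32 : ℝ) ^ (i + 1) * (32 / 31) ^ (i + 1) = 1 := by
        rw [← mul_pow]; norm_num
      have hp : (0 : ℝ) < (31 / 32) ^ (i + 1) := by positivity
      have := mul_lt_mul_of_pos_left hi2 hp
      rw [← mul_assoc, e, one_mul] at this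
      linarith

/-! ### Finding the scale of a small deviation from `π / 6` -/

namespace Program

theorem walk_bind_congr {α : Type} (P : Program α) {f g : α → Program ℝ} {h : List Bool}
    (hfg : ∀ a, ∀ h' : List Bool, h'.length ≤ h.length → (f a).walk h' = (g a).walk h') :
    (P.bind f).walk h = (P.bind g).walk h := by
  induction P generalizing h with
  | ret a => exact hfg a h le_rfl
  | run r next ih =>
    cases h with
    | nil => rfl
    | cons b h =>
      rw [bind, bind, walk, walk]
      exact ih b fun a h' hh' => hfg a h' (hh'.trans (by simp))

theorem prob_le_succ {q : ℕ → ℝ} (hq : ∀ r, 0 ≤ q r ∧ q r ≤ 1) (G : Set ℝ) (P : Program ℝ)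
    {T : ℕ} (hT : P.cost ≤ T) : P.prob q G ≤ P.succ q G T := by
  have hb : P.bind ret = P := by
    clear hT
    induction P with
    | ret a => rfl
    | run r next ih => rw [bind]; congr 1; funext b; exact ih b
  have h := ev_le_succ_bind hq G P ret (G.indicator 1) (T := T) (T' := 0) hT fun a => by
    classical rw [succ, Set.indicator_apply, Pi.one_apply]
  rwa [hb] at h

end Program

/-- The number of Grover iterations for which the angle is multiplied by `3 ^ (j + 1)`. -/
def scaleIterations (j : ℕ) : ℕ := (3 ^ (j + 1) - 1) / 2

theorem two_mul_scaleIterations_add_one (j : ℕ) : 2 * scaleIterations j + 1 = 3 ^ (j + 1) := by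
  have h : Odd (3 ^ (j + 1)) := Odd.pow (by decide)
  obtain ⟨l, hl⟩ := h
  rw [scaleIterations, hl]
  omega

/-- At the angle `π / 6` these experiments never have the result `false`; nearby, the probability
of this result is quadratic in the deviation. -/
theorem one_sub_angleProb_scaleIterations (θ : ℝ) (j : ℕ) :
    1 - angleProb θ (scaleIterations j) = Real.sin (3 ^ (j + 1) * (θ - Real.pi / 6)) ^ 2 := by
  have h1 : (2 * (scaleIterations j : ℝ) + 1) = 3 ^ (j + 1) := by
    exact_mod_cast two_mul_scaleIterations_add_one j
  obtain ⟨l, hl⟩ : Odd (3 ^ j) := Odd.pow (by decide)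
  have hl' : (3 : ℝ) ^ j = 2 * l + 1 := by exact_mod_cast hl
  have e : (3 : ℝ) ^ (j + 1) * θ =
      3 ^ (j + 1) * (θ - Real.pi / 6) + Real.pi / 2 + l * Real.pi := by
    have : (3 : ℝ) ^ (j + 1) * (Real.pi / 6) = (2 * l + 1) * (Real.pi / 2) := by
      rw [← hl']; ring
    rw [mul_sub, this]
    ring
  rw [one_sub_angleProb, h1, e, Real.cos_add_nat_mul_pi, Real.cos_add_pi_div_two, mul_pow, neg_sq,
    ← pow_mul, mul_comm l 2, pow_mul, neg_one_sq, one_pow, one_mul]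

/-- Runs the experiments of the scales `j, j + 1, …` until, at some scale `i`, a quarter of the
results is `false`, and then continues with `E i`. The first argument bounds the number of scales;
the search proper is the limit as this bound grows. -/
def scaleSearch (L : ℕ) (E : ℕ → Program ℝ) : ℕ → ℕ → Program ℝ
  | 0, _ => .ret 0
  | n + 1, j => (Program.countFalse (scaleIterations j) (4 * (16 * L)) 0).bind fun c =>
      if 16 * L ≤ c then E j else scaleSearch L E n (j + 1)

/-- Every scale makes at least one measurement, so the moves after a history `h` do not depend on
a bound larger than the length of `h`. -/
theorem walk_scaleSearch {L : ℕ} (hL : 1 ≤ L) (E : ℕ → Program ℝ) {n n' j : ℕ} {h : List Bool}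
    (hn : h.length < n) (hn' : h.length < n') :
    (scaleSearch L E n j).walk h = (scaleSearch L E n' j).walk h := by
  induction n generalizing n' j h with
  | zero => omega
  | succ n ih =>
    obtain ⟨n', rfl⟩ : ∃ l, n' = l + 1 := ⟨n' - 1, by omega⟩
    obtain ⟨N, hN⟩ : ∃ N, 4 * (16 * L) = N + 1 := ⟨4 * (16 * L) - 1, by omega⟩
    rw [scaleSearch, scaleSearch, hN, Program.countFalse, Program.bind, Program.bind]
    cases h with
    | nil => rfl
    | cons b h =>
      rw [Program.walk, Program.walk]
      refine Program.walk_bind_congr _ fun c h' hh' => ?_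
      rw [List.length_cons] at hn hn'
      split_ifs
      · rfl
      · exact ih (by omega) (by omega)

/-- Success probability of the search. `J` is a scale at which the deviation `φ` is seen with
constant probability. Stopping at a scale `j` with `3 ^ (j + 1) |φ| ≥ 1 / 40` is harmless; at all
earlier scales the probability of stopping decays geometrically with the distance to `J`. -/
theorem succ_scaleSearch_ge {L : ℕ} (hL : 1 ≤ L) (E : ℕ → Program ℝ) {θ : ℝ} {J TE : ℕ} {G : Set ℝ}
    (hφ : 0 < |θ - Real.pi / 6|)
    (hJ1 : Real.pi / 4 ≤ 3 ^ (J + 1) * |θ - Real.pi / 6|)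
    (hJ2 : 3 ^ (J + 1) * |θ - Real.pi / 6| ≤ 3 * Real.pi / 4)
    (hE : ∀ j ≤ J, 1 / 40 ≤ 3 ^ (j + 1) * |θ - Real.pi / 6| →
      1 - (1 / 2 : ℝ) ^ L ≤ (E j).succ (angleProb θ) G TE)
    (d : ℕ) {j n T : ℕ} (hj : j + d = J) (hn : d < n)
    (hT : 256 * L * 3 ^ (J + 2) + TE ≤ T + 256 * L * 3 ^ (j + 1)) :
    1 - (1 / 2 : ℝ) ^ L * (3 - (1 / 9) ^ d) ≤ (scaleSearch L E n j).succ (angleProb θ) G T := by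
  have hpi := Real.pi_gt_d2
  have hpi' := Real.pi_lt_d2
  have hq := angleProb_mem θ
  have hη : (0 : ℝ) < (1 / 2) ^ L := by positivity
  set φ := |θ - Real.pi / 6| with hφdef
  have hcost : ∀ j, (Program.countFalse (scaleIterations j) (4 * (16 * L)) 0).cost =
      256 * L * 3 ^ (j + 1) := by
    intro j
    rw [Program.cost_countFalse, ← two_mul_scaleIterations_add_one]
    ring
  have hsin : ∀ j, 1 - angleProb θ (scaleIterations j) = Real.sin (3 ^ (j + 1) * φ) ^ 2 := by
    intro j
    rw [one_sub_angleProb_scaleIterations, hφdef]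
    rcases abs_choice (θ - Real.pi / 6) with h | h
    · rw [h]
    · rw [h, mul_neg, Real.sin_neg, neg_sq]
  induction d generalizing j n T with
  | zero =>
    obtain rfl : j = J := by omega
    obtain ⟨n, rfl⟩ : ∃ l, n = l + 1 := ⟨n - 1, by omega⟩
    rw [scaleSearch]
    have hhalf : 1 / 2 ≤ 1 - angleProb θ (scaleIterations j) := by
      rw [hsin]
      have : Real.sqrt 2 / 2 ≤ Real.sin (3 ^ (j + 1) * φ) := by
        rw [← Real.sin_pi_div_four]
        by_cases hle : 3 ^ (j + 1) * φ ≤ Real.pi / 2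
        · exact Real.sin_le_sin_of_le_of_le_pi_div_two (by linarith) hle hJ1
        · rw [← Real.sin_pi_sub (3 ^ (j + 1) * φ)]
          exact Real.sin_le_sin_of_le_of_le_pi_div_two (by linarith) (by linarith) (by linarith)
      have h2 := pow_le_pow_left₀ (by positivity) this 2
      rw [div_pow, Real.sq_sqrt (by norm_num)] at h2
      linarith
    have hhit : 1 - (1 / 2 : ℝ) ^ L ≤ (Program.countFalse (scaleIterations j) (4 * (16 * L)) 0).prob
        (angleProb θ) {c | 16 * L ≤ c} := by
      have htail := Program.prob_countFalse_lt_le hq (r := scaleIterations j)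
        (N := 4 * (16 * L)) (g := 1 / 4) (x := (16 * L : ℕ)) (by norm_num) (by norm_num) (by
          have : (0 : ℝ) ≤ (4 * (16 * L) : ℕ) := Nat.cast_nonneg _
          have := mul_le_mul_of_nonneg_right hhalf this
          push_cast at this ⊢
          linarith)
      have hset : {c : ℕ | (c : ℝ) < (16 * L : ℕ)} = {c | 16 * L ≤ c}ᶜ := by
        ext c
        simp only [Set.mem_ofPred_eq, Set.mem_compl_iff, not_le, Nat.cast_lt]
      rw [hset, Program.prob_compl] at htail
      have hexp : Real.exp (-(((4 * (16 * L) : ℕ) : ℝ) * ((1 / 4) ^ 2 / 4))) ≤ (1 / 2) ^ L := by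
        have e : -(((4 * (16 * L) : ℕ) : ℝ) * ((1 / 4) ^ 2 / 4)) = L * (-1) := by
          push_cast; ring
        rw [e, Real.exp_nat_mul]
        refine pow_le_pow_left₀ (Real.exp_pos _).le ?_ _
        rw [Real.exp_neg, one_div]
        exact inv_anti₀ (by norm_num) (by linarith [Real.add_one_le_exp 1])
      linarith
    refine le_trans (le_of_eq ?_) (Program.succ_bind_ge hq G _ _ (η₂ := (1 / 2 : ℝ) ^ L) (T' := TE)
      ?_ hη.le hhit fun c hc => ?_)
    · rw [pow_zero]; ring
    · rw [hcost]
      have : 256 * L * 3 ^ (j + 2) = 3 * (256 * L * 3 ^ (j + 1)) := by ring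
      omega
    · rw [if_pos (show 16 * L ≤ c from hc)]
      exact hE j le_rfl (by linarith)
  | succ d ih =>
    obtain ⟨n, rfl⟩ : ∃ l, n = l + 1 := ⟨n - 1, by omega⟩
    rw [scaleSearch]
    have hmono : TE ≤ T - 256 * L * 3 ^ (j + 1) ∧ 256 * L * 3 ^ (j + 1) ≤ T := by
      have h1 : 256 * L * 3 ^ (j + 2) = 3 * (256 * L * 3 ^ (j + 1)) := by ring
      have h2 : 256 * L * 3 ^ (j + 2) ≤ 256 * L * 3 ^ (J + 2) :=
        Nat.mul_le_mul_left _ (Nat.pow_le_pow_right (by norm_num) (by omega))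
      omega
    have hnext : 1 - (1 / 2 : ℝ) ^ L * (3 - (1 / 9) ^ d) ≤
        (scaleSearch L E n (j + 1)).succ (angleProb θ) G (T - 256 * L * 3 ^ (j + 1)) := by
      refine ih (by omega) (by omega) ?_
      have h1 : 256 * L * 3 ^ (j + 1 + 1) = 3 * (256 * L * 3 ^ (j + 1)) := by ring
      omega
    have hTs : (Program.countFalse (scaleIterations j) (4 * (16 * L)) 0).cost +
        (T - 256 * L * 3 ^ (j + 1)) ≤ T := by
      rw [hcost]
      omega
    have hd1 : (0 : ℝ) < (1 / 9) ^ d := by positivity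
    have hd2 : (1 / 9 : ℝ) ^ d ≤ 1 := pow_le_one₀ (by norm_num) (by norm_num)
    have hη₂ : 0 ≤ (1 / 2 : ℝ) ^ L * (3 - (1 / 9) ^ d) := mul_nonneg hη.le (by linarith)
    by_cases hs : 1 / 40 ≤ 3 ^ (j + 1) * φ
    · have h := Program.succ_bind_ge hq G
        (Program.countFalse (scaleIterations j) (4 * (16 * L)) 0)
        (fun c => if 16 * L ≤ c then E j else scaleSearch L E n (j + 1)) (A := Set.univ) (η₁ := 0)
        hTs hη₂ (by
          rw [Program.prob, Set.indicator_univ]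
          exact le_of_eq (by rw [sub_zero]; exact (Program.ev_const _ 1).symm)) fun c _ => by
          split_ifs
          · refine le_trans ?_ ((hE j (by omega) hs).trans (Program.succ_mono hq G _ hmono.1))
            nlinarith
          · exact hnext
      refine le_trans ?_ h
      have : (1 / 9 : ℝ) ^ (d + 1) = (1 / 9) ^ d * (1 / 9) := pow_succ _ _
      rw [this]
      nlinarith
    · push Not at hs
      -- with `u = 3 ^ (j + 1) φ`, the bound `(16 u²) ^ (16 L)` for the probability of stopping
      have hu0 : 0 < 3 ^ (j + 1) * φ := by positivity
      have hfalse := Program.prob_countFalse_mul_le hq (r := scaleIterations j) (L := 16 * L)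
        (p := (3 ^ (j + 1) * φ) ^ 2) (by positivity)
        (pow_le_one₀ hu0.le (by linarith)) (by
          rw [hsin]
          exact pow_le_pow_left₀ (Real.sin_nonneg_of_nonneg_of_le_pi hu0.le (by linarith))
            (Real.sin_le hu0.le) 2)
      have hbound : (16 * (3 ^ (j + 1) * φ) ^ 2) ^ (16 * L) ≤
          (1 / 2 : ℝ) ^ L * (8 * (1 / 9) ^ (d + 1)) := by
        have hJj : (3 : ℝ) ^ (J + 1) = 3 ^ (j + 1) * 3 ^ (d + 1) := by
          rw [← pow_add]; congr 1; omega
        have hu1 : (3 ^ (j + 1) * φ) ^ 2 ≤ 8 * (1 / 9) ^ (d + 1) := by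
          have h1 : 3 ^ (j + 1) * φ * 3 ^ (d + 1) ≤ 12 / 5 := by
            rw [hJj] at hJ2
            linarith
          have h2 := pow_le_pow_left₀ (by positivity) h1 2
          rw [mul_pow, ← pow_mul, mul_comm (d + 1) 2, pow_mul] at h2
          have h3 : (0 : ℝ) < (3 ^ 2) ^ (d + 1) := by positivity
          rw [one_div_pow, mul_one_div, le_div_iff₀ (by positivity)]
          norm_num at h2 ⊢
          linarith
        have hv0 : 0 ≤ 16 * (3 ^ (j + 1) * φ) ^ 2 := by positivity
        have hv1 : 16 * (3 ^ (j + 1) * φ) ^ 2 ≤ 1 / 100 := by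
          have := pow_le_pow_left₀ hu0.le hs.le 2
          linarith
        obtain ⟨l, hl⟩ : ∃ l, 16 * L = L + 1 + (l + 1) := ⟨15 * L - 2, by omega⟩
        calc (16 * (3 ^ (j + 1) * φ) ^ 2) ^ (16 * L)
            = (16 * (3 ^ (j + 1) * φ) ^ 2) ^ L * (16 * (3 ^ (j + 1) * φ) ^ 2) *
              (16 * (3 ^ (j + 1) * φ) ^ 2) ^ (l + 1) := by
              rw [hl, pow_add, pow_succ _ L]
          _ ≤ (1 / 2) ^ L * (16 * (8 * (1 / 9) ^ (d + 1))) * (1 / 100) := by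
              refine mul_le_mul (mul_le_mul (pow_le_pow_left₀ hv0 (by linarith) _) (by linarith)
                hv0 hη.le) ?_ (by positivity) (by positivity)
              rw [pow_succ]
              have := pow_le_one₀ (n := l) hv0 (by linarith)
              nlinarith
          _ ≤ (1 / 2 : ℝ) ^ L * (8 * (1 / 9) ^ (d + 1)) := by
              have : (0 : ℝ) ≤ (1 / 2) ^ L * (8 * (1 / 9) ^ (d + 1)) := by positivity
              linarith
      have h := Program.succ_bind_ge hq G
        (Program.countFalse (scaleIterations j) (4 * (16 * L)) 0)
        (fun c => if 16 * L ≤ c then E j else scaleSearch L E n (j + 1)) (A := {c | 16 * L ≤ c}ᶜ)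
        (η₁ := (1 / 2 : ℝ) ^ L * (8 * (1 / 9) ^ (d + 1))) hTs hη₂ (by
          rw [Program.prob_compl]
          linarith) fun c hc => by
          rw [if_neg (show ¬16 * L ≤ c from hc)]
          exact hnext
      refine le_trans (le_of_eq ?_) h
      rw [pow_succ]
      ring

/-! ### Estimation to a given relative precision -/

/-- The sine of an angle estimate is an amplitude estimate of the same precision. -/
theorem exists_amplitude_estimation (L : ℕ) {τ : ℝ} (hτ : 0 < τ) (hτ1 : τ ≤ 1) :
    ∃ P : Program ℝ, (P.cost : ℝ) ≤ 10 ^ 11 * (L + 1) / τ ∧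
      ∀ θ ∈ Set.Icc 0 (Real.pi / 2), 1 - (1 / 2 : ℝ) ^ L ≤
        P.prob (angleProb θ) {a | |a - Real.sin θ| ≤ τ} := by
  obtain ⟨P, hPc, hP⟩ := exists_angle_estimation L hτ hτ1
  refine ⟨P.bind fun a => .ret (Real.sin a), ?_, fun θ hθ => (hP θ hθ).trans ?_⟩
  · refine le_trans (Nat.cast_le.2 ?_) hPc
    exact P.cost_bind_le _ (c := 0) fun _ => le_rfl
  · rw [Program.prob, Program.prob, Program.ev_bind]
    refine Program.ev_mono (angleProb_mem θ) _ fun a => ?_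
    exact Set.indicator_le_indicator_of_subset (s := {a | |a - θ| ≤ τ})
      (t := {a | |Real.sin a - Real.sin θ| ≤ τ}) (f := (1 : ℝ → ℝ))
      (fun a ha => (Real.abs_sin_sub_sin_le a θ).trans ha) (fun _ => zero_le_one) a

theorem abs_le_two_mul_abs_sub {x θ : ℝ} (hx : Real.sin θ = (1 + x) / 2) :
    |x| ≤ 2 * |θ - Real.pi / 6| := by
  have h := Real.abs_sin_sub_sin_le θ (Real.pi / 6)
  rw [hx, Real.sin_pi_div_six] at h
  have e : (1 + x) / 2 - 1 / 2 = x / 2 := by ring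
  rw [e, abs_div, abs_two] at h
  linarith

theorem abs_sub_le_two_mul_abs {x θ : ℝ} (hθ : θ ∈ Set.Icc 0 (Real.pi / 2))
    (hx : Real.sin θ = (1 + x) / 2) : |θ - Real.pi / 6| ≤ 2 * |x| := by
  have hpi := Real.pi_pos
  have h := Real.sin_sub_sin θ (Real.pi / 6)
  rw [hx, Real.sin_pi_div_six] at h
  set u := (θ - Real.pi / 6) / 2 with hu
  have hcos : 1 / 2 ≤ Real.cos ((θ + Real.pi / 6) / 2) := by
    rw [← Real.cos_pi_div_three]
    exact Real.cos_le_cos_of_nonneg_of_le_pi (by linarith [hθ.1]) (by linarith)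
      (by linarith [hθ.2])
  have hu1 : |u| ≤ Real.pi / 2 := by
    rw [hu, abs_le]; constructor <;> linarith [hθ.1, hθ.2]
  have hsin : |u| / 2 ≤ |Real.sin u| := by
    refine (div_two_le_sin (abs_nonneg u) hu1).trans ?_
    rcases abs_choice u with h | h
    · rw [h]; exact le_abs_self _
    · rw [h, Real.sin_neg]; exact neg_le_abs _
  have e : x = 4 * (Real.sin u * Real.cos ((θ + Real.pi / 6) / 2)) := by linarith
  have e2 : |x| = 4 * (|Real.sin u| * Real.cos ((θ + Real.pi / 6) / 2)) := by
    rw [e, abs_mul, abs_mul, abs_of_pos (by norm_num : (0 : ℝ) < 4),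
      abs_of_pos (by linarith : 0 < Real.cos ((θ + Real.pi / 6) / 2))]
  have e3 : |θ - Real.pi / 6| = 2 * |u| := by
    rw [hu, abs_div, abs_two]; ring
  have := mul_le_mul hsin hcos (by norm_num) (abs_nonneg _)
  rw [e2, e3]
  linarith

/-- The whole procedure: a rough estimate of the angle; if it is close to `π / 6`, the search for the
scale of the deviation; and an estimate with a precision adapted to this scale. -/
theorem exists_controller {ε : ℝ} (hε : 0 < ε) (hε1 : ε < 1) {L : ℕ} (hL : 1 ≤ L) :
    ∃ ctrl : Controller, ∀ (m n k : ℕ)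
      (UB : Matrix (Qubits n × Qubits k) (Qubits n × Qubits k) ℂ)
      (US : Matrix (Qubits m × (Fin 2 × Qubits n)) (Qubits m × (Fin 2 × Qubits n)) ℂ)
      (p : Part) (θ x : ℝ) (G : Set ℝ), zeroProb UB US p = angleProb θ →
      θ ∈ Set.Icc 0 (Real.pi / 2) → Real.sin θ = (1 + x) / 2 → x ≠ 0 → |x| ≤ 1 →
      (∀ a, |2 * a - 1 - x| ≤ ε * |x| → a ∈ G) →
      ∃ T : ℕ, (T : ℝ) ≤ 3 * 10 ^ 14 * ((L + 1) / (ε * |x|)) ∧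
        1 - 4 * (1 / 2 : ℝ) ^ L ≤ successProb UB US p ctrl G T [] := by
  have hE : ∀ s : ℝ, 0 < s ∧ s ≤ 1 → ∃ P : Program ℝ,
      (P.cost : ℝ) ≤ 10 ^ 11 * (L + 1) / (ε * s / 4) ∧
      ∀ θ ∈ Set.Icc 0 (Real.pi / 2), 1 - (1 / 2 : ℝ) ^ L ≤
        P.prob (angleProb θ) {a | |a - Real.sin θ| ≤ ε * s / 4} := fun s hs =>
    exists_amplitude_estimation L (by have := mul_pos hε hs.1; linarith) (by
      have := mul_le_mul hε1.le hs.2 hs.1.le zero_le_one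
      linarith)
  have : Nonempty (Program ℝ) := ⟨.ret 0⟩
  choose! Est hEstc hEst using hE
  obtain ⟨P₀, hP₀c, hP₀⟩ := exists_angle_estimation L (τ := 1 / 20) (by norm_num) (by norm_num)
  -- the scale belonging to stopping the search at `j`
  set sc : ℕ → ℝ := fun j => 1 / (40 * 3 ^ (j + 1)) with hsc
  have hsc01 : ∀ j, 0 < sc j ∧ sc j ≤ 1 := by
    intro j
    have h1 : (1 : ℝ) ≤ 3 ^ (j + 1) := one_le_pow₀ (by norm_num)
    refine ⟨by rw [hsc]; positivity, ?_⟩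
    change 1 / (40 * 3 ^ (j + 1)) ≤ (1 : ℝ)
    rw [div_le_one (by positivity)]
    linarith
  set inner : ℕ → ℝ → Program ℝ := fun N a => if 1 / 10 < |a - Real.pi / 6| then Est (1 / 20) else
    scaleSearch L (fun j => Est (sc j)) N 0 with hinner
  refine ⟨fun h => (P₀.bind (inner (h.length + 1))).walk h.reverse, ?_⟩
  intro m n k UB US p θ x G hzero hθ hx hx0 hx1 hG
  have hpi := Real.pi_gt_d2
  have hpi' := Real.pi_lt_d2
  have hq := angleProb_mem θ
  have hη : (0 : ℝ) < (1 / 2) ^ L := by positivity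
  have hxpos : 0 < |x| := abs_pos.2 hx0
  set φ := |θ - Real.pi / 6| with hφdef
  have hφ1 := abs_le_two_mul_abs_sub hx
  have hφ2 := abs_sub_le_two_mul_abs hθ hx
  rw [← hφdef] at hφ1 hφ2
  have hφ0 : 0 < φ := by linarith
  set X : ℝ := (L + 1) / (ε * |x|) with hX
  have hXpos : 0 < X := by positivity
  -- an estimate with a precision adapted to a lower bound `s` for the deviation is good
  have hgood : ∀ s, 0 < s ∧ s ≤ 1 → s ≤ φ →
      1 - (1 / 2 : ℝ) ^ L ≤ (Est s).prob (angleProb θ) G := by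
    intro s hs hsφ
    refine (hEst s hs θ hθ).trans (Program.prob_mono hq _ fun a ha => hG a ?_)
    have ha' : |a - Real.sin θ| ≤ ε * s / 4 := ha
    have e : 2 * a - 1 - x = 2 * (a - Real.sin θ) := by rw [hx]; ring
    rw [e, abs_mul, abs_two]
    have := mul_le_mul_of_nonneg_left (hsφ.trans hφ2) hε.le
    linarith
  have hcost : ∀ s, 0 < s ∧ s ≤ 1 → |x| ≤ 240 * s →
      (Est s).cost ≤ ⌊(10 : ℝ) ^ 14 * X⌋₊ := by
    intro s hs hsx
    refine Nat.le_floor ((hEstc s hs).trans ?_)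
    rw [div_le_iff₀ (by have := mul_pos hε hs.1; linarith)]
    have e : (10 : ℝ) ^ 14 * X * (ε * s / 4) = 10 ^ 14 / 4 * (L + 1) * (s / |x|) := by
      rw [hX]
      field_simp
    rw [e]
    have h1 : 1 / 240 ≤ s / |x| := by
      rw [le_div_iff₀ hxpos]; linarith
    have := mul_le_mul_of_nonneg_left h1 (by positivity : (0 : ℝ) ≤ 10 ^ 14 / 4 * (L + 1))
    have hL0 : (0 : ℝ) ≤ L := Nat.cast_nonneg L
    linarith
  set T' : ℕ := ⌊2 * (10 : ℝ) ^ 14 * X⌋₊ with hT'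
  have hfloor : ⌊(10 : ℝ) ^ 14 * X⌋₊ ≤ T' := Nat.floor_le_floor (by linarith)
  -- with enough scales the second stage succeeds after every good rough estimate
  obtain ⟨N₀, hN₀⟩ : ∃ N₀ : ℕ, ∀ N, N₀ ≤ N → ∀ a ∈ {a : ℝ | |a - θ| ≤ 1 / 20},
      1 - 3 * (1 / 2 : ℝ) ^ L ≤ (inner N a).succ (angleProb θ) G T' := by
    by_cases hφs : φ ≤ 3 / 20
    · obtain ⟨i, hi1, hi2⟩ := exists_nat_pow_near (x := Real.pi / 4 / (3 * φ)) (y := (3 : ℝ))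
        (by rw [le_div_iff₀ (by positivity)]; linarith) (by norm_num)
      rw [le_div_iff₀ (by positivity)] at hi1
      rw [div_lt_iff₀ (by positivity)] at hi2
      have hpow1 : (3 : ℝ) ^ (i + 1 + 1) * φ = 3 ^ (i + 1) * (3 * φ) := by ring
      have hpow2 : (3 : ℝ) ^ (i + 1) * (3 * φ) = 3 * (3 ^ i * (3 * φ)) := by ring
      refine ⟨i + 2, fun N hN a ha => ?_⟩
      rw [hinner]
      dsimp only
      split_ifs with hfar
      · have ha' : |a - θ| ≤ 1 / 20 := ha
        have hs : 1 / 20 ≤ φ := by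
          have := abs_sub_le a θ (Real.pi / 6)
          linarith
        refine le_trans ?_ ((hgood (1 / 20) (by norm_num) hs).trans
          (Program.prob_le_succ hq G _ ((hcost _ (by norm_num) (by linarith)).trans hfloor)))
        linarith
      · have hsearch := succ_scaleSearch_ge hL (fun j => Est (sc j)) (J := i + 1)
          (TE := ⌊(10 : ℝ) ^ 14 * X⌋₊) (G := G) hφ0 (by rw [← hφdef, hpow1]; exact hi2.le)
          (by rw [← hφdef, hpow1, hpow2]; linarith)
          (fun j hj hs => by
            rw [← hφdef] at hs
            have h3 : (0 : ℝ) < 3 ^ (j + 1) := by positivity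
            refine (hgood (sc j) (hsc01 j) ?_).trans (Program.prob_le_succ hq G _
              (hcost (sc j) (hsc01 j) ?_))
            · change 1 / (40 * 3 ^ (j + 1)) ≤ φ
              rw [div_le_iff₀ (by positivity)]
              linarith
            · change |x| ≤ 240 * (1 / (40 * 3 ^ (j + 1)))
              have h3j : (3 : ℝ) ^ (j + 1) ≤ 3 ^ (i + 1 + 1) :=
                pow_le_pow_right₀ (by norm_num) (by omega)
              rw [mul_one_div, le_div_iff₀ (by positivity)]
              have := mul_le_mul_of_nonneg_right h3j hφ0.le
              have := mul_le_mul_of_nonneg_right hφ1 h3.le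
              linarith)
          (i + 1) (j := 0) (n := N) (T := T') (by omega) (by omega) (by
            refine le_trans ?_ (Nat.le_add_right _ _)
            refine Nat.le_floor ?_
            rw [Nat.cast_add]
            have hf := Nat.floor_le (by positivity : 0 ≤ (10 : ℝ) ^ 14 * X)
            have hc : ((256 * L * 3 ^ (i + 1 + 2) : ℕ) : ℝ) ≤ (10 : ℝ) ^ 14 * X := by
              have e : (10 : ℝ) ^ 14 * X = 10 ^ 14 * (L + 1) / ε / |x| := by
                rw [hX]; field_simp
              rw [e, le_div_iff₀ hxpos]
              have h3 : (0 : ℝ) ≤ 3 ^ (i + 1 + 2) := by positivity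
              have h4 : (3 : ℝ) ^ (i + 1 + 2) * |x| ≤ 100 := by
                have := mul_le_mul_of_nonneg_left hφ1 h3
                have e2 : (3 : ℝ) ^ (i + 1 + 2) * (2 * φ) = 18 * (3 ^ i * (3 * φ)) := by ring
                linarith
              have h5 : (L : ℝ) + 1 ≤ (L + 1) / ε := by
                rw [le_div_iff₀ hε]
                have : (0 : ℝ) ≤ L + 1 := by positivity
                nlinarith
              have h6 := mul_le_mul_of_nonneg_left h4 (by positivity : (0 : ℝ) ≤ 256 * L)
              push_cast
              rw [mul_div_assoc]
              have hL0 : (0 : ℝ) ≤ L := Nat.cast_nonneg L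
              linarith
            linarith)
        refine le_trans ?_ hsearch
        have : (0 : ℝ) < (1 / 9) ^ (i + 1) := by positivity
        nlinarith
    · refine ⟨0, fun N _ a ha => ?_⟩
      push Not at hφs
      have ha' : |a - θ| ≤ 1 / 20 := ha
      have hfar : 1 / 10 < |a - Real.pi / 6| := by
        have := abs_sub_le θ a (Real.pi / 6)
        rw [abs_sub_comm θ a] at this
        linarith
      rw [hinner]
      dsimp only
      rw [if_pos hfar]
      refine le_trans ?_ ((hgood (1 / 20) (by norm_num) (by linarith)).trans
        (Program.prob_le_succ hq G _ ((hcost _ (by norm_num) (by linarith)).trans hfloor)))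
      linarith
  refine ⟨P₀.cost + T', ?_, ?_⟩
  · rw [Nat.cast_add]
    have hf := Nat.floor_le (by positivity : 0 ≤ 2 * (10 : ℝ) ^ 14 * X)
    have hLX : (L : ℝ) + 1 ≤ X := by
      rw [hX, le_div_iff₀ (by positivity)]
      have h1 : ε * |x| ≤ 1 := mul_le_one₀ hε1.le (abs_nonneg _) hx1
      have h2 : (0 : ℝ) ≤ L + 1 := by positivity
      nlinarith
    rw [div_eq_mul_inv] at hP₀c
    norm_num at hP₀c
    linarith
  · rw [Program.successProb_eq_succ UB US p _ G
      (P₀.bind (inner (max N₀ (P₀.cost + T' + 1)))) _ _ ?_, hzero]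
    · refine le_trans (le_of_eq ?_) (Program.succ_bind_ge hq G P₀ _ le_rfl
        (by positivity : (0 : ℝ) ≤ 3 * (1 / 2) ^ L) (hP₀ θ hθ) (hN₀ _ (le_max_left _ _)))
      ring
    · intro h' hh'
      rw [List.append_nil]
      refine Program.walk_bind_congr _ fun a h'' hh'' => ?_
      rw [List.length_reverse] at hh''
      rw [hinner]
      dsimp only
      split_ifs
      · rfl
      · exact walk_scaleSearch hL _ (by omega) (by omega)

/-- The number of repetitions needed for failure probability `δ`. -/
theorem exists_repetitions {δ₀ δ : ℝ} (h0 : 0 < δ) (h1 : δ ≤ δ₀) (h2 : δ₀ < 1) :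
    ∃ L : ℕ, 1 ≤ L ∧ 4 * (1 / 2 : ℝ) ^ L ≤ δ ∧
      (L : ℝ) + 1 ≤ (4 / Real.log δ₀⁻¹ + 2) * Real.log δ⁻¹ := by
  have hlog2 := Real.log_two_gt_d9
  have hδ₀ : 0 < δ₀ := h0.trans_le h1
  have hl0 : 0 < Real.log δ₀⁻¹ := Real.log_pos ((one_lt_inv₀ hδ₀).2 h2)
  have hl : Real.log δ₀⁻¹ ≤ Real.log δ⁻¹ :=
    Real.log_le_log (inv_pos.2 hδ₀) (inv_anti₀ h0 h1)
  have h4 : Real.log 4 = 2 * Real.log 2 := by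
    rw [show (4 : ℝ) = 2 ^ 2 by norm_num, Real.log_pow]; norm_num
  have hy : 0 ≤ (Real.log 4 + Real.log δ⁻¹) / Real.log 2 := by
    apply div_nonneg <;> linarith
  refine ⟨⌈(Real.log 4 + Real.log δ⁻¹) / Real.log 2⌉₊, Nat.ceil_pos.2 ?_, ?_, ?_⟩
  · apply div_pos <;> linarith
  · have hc := Nat.le_ceil ((Real.log 4 + Real.log δ⁻¹) / Real.log 2)
    set L := ⌈(Real.log 4 + Real.log δ⁻¹) / Real.log 2⌉₊
    rw [div_le_iff₀ (by linarith), ← Real.log_mul (by norm_num) (by positivity), ← Real.log_pow,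
      Real.log_le_log_iff (by positivity) (by positivity)] at hc
    rw [one_div_pow, mul_one_div, div_le_iff₀ (by positivity)]
    calc 4 = δ * (4 * δ⁻¹) := by field_simp
      _ ≤ δ * 2 ^ L := mul_le_mul_of_nonneg_left hc h0.le
  · have hc := Nat.ceil_lt_add_one hy
    have e : (Real.log 4 + Real.log δ⁻¹) / Real.log 2 ≤ 2 + 2 * Real.log δ⁻¹ := by
      rw [div_le_iff₀ (by linarith), h4]
      nlinarith
    have h5 : 4 ≤ 4 / Real.log δ₀⁻¹ * Real.log δ⁻¹ := by
      rw [div_mul_eq_mul_div, le_div_iff₀ hl0]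
      linarith
    linarith

end StateMatrixization

theorem mainTheorem2 :
    ∀ δ₀ : ℝ, δ₀ < 1 → ∃ C : ℝ, 0 < C ∧
      ∀ ε δ : ℝ, 0 < ε → 0 < δ → δ ≤ δ₀ → ∃ ctrl : Controller,
        ∀ (m n k : ℕ) (lam γ : ℝ) (A B : Ket (Qubits n × Qubits n))
          (UB : Matrix (Qubits n × Qubits k) (Qubits n × Qubits k) ℂ)
          (ρA : Matrix (Fin 2 × Qubits n) (Fin 2 × Qubits n) ℂ)
          (SA : Ket (Qubits m × (Fin 2 × Qubits n)))
          (US : Matrix (Qubits m × (Fin 2 × Qubits n)) (Qubits m × (Fin 2 × Qubits n)) ℂ),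
          0 < lam → 0 < γ →
          IsUBSE UB lam B → IsDMSE ρA 0 1 γ A → IsPurification SA ρA →
          US ∈ Matrix.unitaryGroup (Qubits m × (Fin 2 × Qubits n)) ℂ →
          US *ᵥ basisKet 0 = SA →
          ∀ p : Part,
            (∀ r : ℕ, (experiment m n k p r).eval UB US =
              (Gate.queryS true : Gate m n k).eval UB US * groverOp UB SA p ^ r *
                ctrlLCU m UB p * (Gate.queryS false : Gate m n k).eval UB US) ∧
            (2 * ‖braket (initKet k SA) (ctrlLCU m UB p *ᵥ initKet k SA)‖ - 1) / (γ * lam) =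
              p.of (braket B A) ∧
            (p.of (braket B A) ≠ 0 → ∃ T : ℕ,
              (T : ℝ) ≤ C * (γ⁻¹ * lam⁻¹ * |p.of (braket B A)|⁻¹ * ε⁻¹ * Real.log δ⁻¹) ∧
              1 - δ ≤ successProb UB US p ctrl
                {a : ℝ | |(2 * a - 1) / (γ * lam) - p.of (braket B A)| ≤
                  ε * |p.of (braket B A)|} T []) := by
  intro δ₀ hδ₀
  -- the parts of the claim that do not involve the procedure
  have parts : ∀ {m n k : ℕ} {lam γ : ℝ} {A B : Ket (Qubits n × Qubits n)}
      {UB : Matrix (Qubits n × Qubits k) (Qubits n × Qubits k) ℂ}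
      {ρA : Matrix (Fin 2 × Qubits n) (Fin 2 × Qubits n) ℂ}
      {SA : Ket (Qubits m × (Fin 2 × Qubits n))}, 0 < lam → 0 < γ →
      IsUBSE UB lam B → IsDMSE ρA 0 1 γ A → IsPurification SA ρA → ∀ p : Part,
      (2 * ‖braket (initKet k SA) (ctrlLCU m UB p *ᵥ initKet k SA)‖ - 1) / (γ * lam) =
        p.of (braket B A) := by
    intro m n k lam γ A B UB ρA SA hlam hγ hB hA hS p
    have habs := abs_le.1 (abs_amplitude_le_one hB hA hS p)
    rw [braket_ctrlLCU hB hA hS p, Complex.norm_real, Real.norm_eq_abs,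
      abs_of_nonneg (by linarith [habs.1])]
    field_simp
    ring
  by_cases hpos : 0 < δ₀
  swap
  · exact ⟨1, one_pos, fun ε δ _ hδ hδδ => absurd (hδ.trans_le hδδ) hpos⟩
  have hl0 : 0 < Real.log δ₀⁻¹ := Real.log_pos ((one_lt_inv₀ hpos).2 hδ₀)
  refine ⟨3 * 10 ^ 14 * (4 / Real.log δ₀⁻¹ + 2), by positivity, fun ε δ hε hδ hδδ => ?_⟩
  have hlδ : 0 < Real.log δ⁻¹ := Real.log_pos ((one_lt_inv₀ hδ).2 (hδδ.trans_lt hδ₀))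
  by_cases hε1 : 1 ≤ ε
  · -- the estimate `0` of `μ` has relative error `1`
    refine ⟨fun _ => .output (1 / 2), ?_⟩
    intro m n k lam γ A B UB ρA SA US hlam hγ hB hA hS hUS hSA p
    refine ⟨eval_experiment UB US hB.1 hUS hSA p, parts hlam hγ hB hA hS p, fun hμ => ⟨0, ?_, ?_⟩⟩
    · rw [Nat.cast_zero]
      positivity
    · rw [successProb]
      dsimp only
      rw [if_pos]
      · linarith
      · change |(2 * (1 / 2 : ℝ) - 1) / (γ * lam) - p.of (braket B A)| ≤ _
        rw [show (2 * (1 / 2 : ℝ) - 1) / (γ * lam) - p.of (braket B A) = -p.of (braket B A) by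
          norm_num, abs_neg]
        exact le_mul_of_one_le_left (abs_nonneg _) hε1
  push Not at hε1
  obtain ⟨L, hL1, hLδ, hL⟩ := exists_repetitions hδ hδδ hδ₀
  obtain ⟨ctrl, hctrl⟩ := exists_controller hε hε1 hL1
  refine ⟨ctrl, ?_⟩
  intro m n k lam γ A B UB ρA SA US hlam hγ hB hA hS hUS hSA p
  refine ⟨eval_experiment UB US hB.1 hUS hSA p, parts hlam hγ hB hA hS p, fun hμ => ?_⟩
  set μ := p.of (braket B A) with hμdef
  have hx1 : |γ * lam * μ| ≤ 1 := abs_amplitude_le_one hB hA hS p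
  have hx1' := abs_le.1 hx1
  have hγl : 0 < γ * lam := mul_pos hγ hlam
  have hsin : Real.sin (Real.arcsin ((1 + γ * lam * μ) / 2)) = (1 + γ * lam * μ) / 2 :=
    Real.sin_arcsin (by linarith) (by linarith)
  obtain ⟨T, hT, hsucc⟩ := hctrl m n k UB US p (Real.arcsin ((1 + γ * lam * μ) / 2)) (γ * lam * μ)
    {a : ℝ | |(2 * a - 1) / (γ * lam) - μ| ≤ ε * |μ|}
    (funext fun r => zeroProb_eq hB hA hS hUS hSA p hsin r)
    ⟨Real.arcsin_nonneg.2 (by linarith), Real.arcsin_le_pi_div_two _⟩ hsin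
    (mul_ne_zero hγl.ne' hμ) hx1 (by
      intro a ha
      change |(2 * a - 1) / (γ * lam) - μ| ≤ ε * |μ|
      have e : (2 * a - 1) / (γ * lam) - μ = (2 * a - 1 - γ * lam * μ) / (γ * lam) := by
        field_simp
      rw [e, abs_div, abs_of_pos hγl, div_le_iff₀ hγl]
      rw [abs_mul, abs_of_pos hγl] at ha
      linarith)
  refine ⟨T, hT.trans ?_, le_trans (by linarith) hsucc⟩
  rw [abs_mul, abs_of_pos hγl]
  have e : (3 : ℝ) * 10 ^ 14 * (4 / Real.log δ₀⁻¹ + 2) *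
      (γ⁻¹ * lam⁻¹ * |μ|⁻¹ * ε⁻¹ * Real.log δ⁻¹) =
      3 * 10 ^ 14 * (((4 / Real.log δ₀⁻¹ + 2) * Real.log δ⁻¹) / (ε * (γ * lam * |μ|))) := by
    rw [div_eq_mul_inv _ (ε * _)]
    simp only [mul_inv]
    ring
  rw [e]
  have : 0 < |μ| := abs_pos.2 hμ
  gcongr
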